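/- Let $G=(V,E)$ be a finite simple graph, and let $P_G$ be its vertex-edge incidence poset, i.e. the poset on $V\sqcup E$ whose only relations besides reflexivity are $v\le e$ for each edge $e\in E$ and each endpoint $v$ of $e$. A graph is called a Stick graph if it is the intersection graph of a family of non-degenerate horizontal and vertical segments in the plane such that, for some line $\ell$ of positive slope, every horizontal segment has its left endpoint on $\ell$ and every vertical segment has its top endpoint on $\ell$, and parallel segments of the family are pairwise disjoint. A poset is called a Stick graph if its comparability graph (distinct elements adjacent if and only if they are comparable) is one. A graph is outerplanar if it has a crossing-free drawing in the plane (vertices as distinct points, edges as simple arcs) in which every vertex lies on the boundary of the outer (unbounded) face. Then $P_G$ is a Stick graph if and only if $G$ is outerplanar. -/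

import Mathlib

universe u

/-! ### Comparability graphs and vertex-edge incidence posets -/

/-- The comparability graph of a poset: distinct elements are adjacent iff they are comparable. -/
def comparabilityGraph (P : Type u) [PartialOrder P] : SimpleGraph P where
  Adj x y := x ≠ y ∧ (x ≤ y ∨ y ≤ x)
  symm := ⟨fun _ _ h => ⟨h.1.symm, h.2.symm⟩⟩
  loopless := ⟨fun _ h => h.1 rfl⟩

/-- The ground set of the vertex-edge incidence poset `P_G` of a graph `G`: the vertices
together with the edges of `G`. -/
inductive IncidencePoset {V : Type u} (G : SimpleGraph V) : Type u
  | vertex (v : V) : IncidencePoset G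
  | edge (e : G.edgeSet) : IncidencePoset G

namespace IncidencePoset

/-- The order of `P_G`: besides the reflexive relations, exactly `v ≤ e` for every vertex `v`
that is an endpoint of the edge `e`. -/
inductive Le {V : Type u} (G : SimpleGraph V) : IncidencePoset G → IncidencePoset G → Prop
  | refl (x : IncidencePoset G) : Le G x x
  | incident (v : V) (e : G.edgeSet) (h : v ∈ (e : Sym2 V)) : Le G (vertex v) (edge e)

instance instPartialOrder {V : Type u} (G : SimpleGraph V) : PartialOrder (IncidencePoset G) where
  le := Le G
  le_refl := Le.refl
  le_trans := by
    intro a b c hab hbc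
    cases hab with
    | refl => exact hbc
    | incident v e h =>
      cases hbc with
      | refl => exact Le.incident v e h
  le_antisymm := by
    intro a b hab hba
    cases hab with
    | refl => rfl
    | incident v e h => cases hba

end IncidencePoset

/-! ### Stick graphs -/

/-- The stick of length `r` attached at the point of the line `y = m * x + b` with abscissa `x`.
A horizontal stick has its left endpoint, a vertical stick its top endpoint, on the line. -/
def stick (m b : ℝ) (horizontal : Bool) (x r : ℝ) : Set (ℝ × ℝ) :=
  if horizontal then segment ℝ (x, m * x + b) (x + r, m * x + b)
  else segment ℝ (x, m * x + b) (x, m * x + b - r)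

/-- A stick representation of a graph `H`: a line with positive slope and, for each vertex of `H`,
a horizontal or vertical segment with its left respectively top endpoint on the line, such that
parallel segments are disjoint and `H` is the intersection graph of the segments. -/
structure StickRepresentation {W : Type u} (H : SimpleGraph W) where
  slope : ℝ
  intercept : ℝ
  slope_pos : 0 < slope
  horizontal : W → Bool
  foot : W → ℝ
  length : W → ℝ
  length_pos : ∀ w, 0 < length w
  parallel_disjoint : ∀ v w, v ≠ w → horizontal v = horizontal w →
    Disjoint (stick slope intercept (horizontal v) (foot v) (length v))
      (stick slope intercept (horizontal w) (foot w) (length w))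
  adj_iff : ∀ v w, H.Adj v w ↔ v ≠ w ∧
    (stick slope intercept (horizontal v) (foot v) (length v) ∩
      stick slope intercept (horizontal w) (foot w) (length w)).Nonempty

/-- A graph is a Stick graph if it has a stick representation. -/
def IsStickGraph {W : Type u} (H : SimpleGraph W) : Prop :=
  Nonempty (StickRepresentation H)

/-! ### Outerplanar graphs -/

/-- A plane drawing (planar embedding) of a graph: vertices are distinct points of the plane,
every edge is a simple arc joining the points of its two endpoints, the interior of an edge
contains no vertex and no point of another edge. -/
structure PlaneDrawing {V : Type u} (G : SimpleGraph V) where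
  point : V → ℝ × ℝ
  point_injective : Function.Injective point
  arc : G.edgeSet → unitInterval → ℝ × ℝ
  arc_continuous : ∀ e, Continuous (arc e)
  arc_injective : ∀ e, Function.Injective (arc e)
  arc_endpoints : ∀ e : G.edgeSet, s(arc e 0, arc e 1) = (e : Sym2 V).map point
  arc_ne_point : ∀ (e : G.edgeSet) (t : unitInterval), 0 < t → t < 1 → ∀ v, arc e t ≠ point v
  arc_ne_arc : ∀ e f : G.edgeSet, e ≠ f → ∀ t s : unitInterval, 0 < t → t < 1 → arc e t ≠ arc f s

namespace PlaneDrawing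

/-- The set of points of the plane covered by the drawing. -/
def support {V : Type u} {G : SimpleGraph V} (D : PlaneDrawing G) : Set (ℝ × ℝ) :=
  Set.range D.point ∪ ⋃ e, Set.range (D.arc e)

/-- The outer face: the points off the drawing whose connected component in the complement of the
drawing is unbounded. -/
def outerFace {V : Type u} {G : SimpleGraph V} (D : PlaneDrawing G) : Set (ℝ × ℝ) :=
  {z | z ∈ D.supportᶜ ∧ ¬ Bornology.IsBounded (connectedComponentIn D.supportᶜ z)}

end PlaneDrawing

/-- A graph is outerplanar if it has a plane drawing in which every vertex lies on the boundary of
the outer face. -/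
def IsOuterplanar {V : Type u} (G : SimpleGraph V) : Prop :=
  ∃ D : PlaneDrawing G, ∀ v, D.point v ∈ frontier D.outerFace

/-! Both properties are equivalent to a linear order of the vertices in which no two edges
interleave (`IsNoncrossingOrder`).

From sticks to an order: every edge stick is perpendicular to the sticks of its endpoints, so
adjacent vertices have parallel sticks. Among parallel vertex sticks, interleaved edges would force
each of two edge feet to lie strictly beyond the other (`not_crossing_of_horizontal`,
`not_crossing_of_vertical`). Conversely, a noncrossing order supplies the feet of the vertex sticks,
and each edge foot goes just beyond the foot of the later endpoint
(`IsNoncrossingOrder.isStickGraph`).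

From an order to a drawing: put the vertices on a parabola and draw edges as chords; everything
below the parabola belongs to the outer face (`IsNoncrossingOrder.isOuterplanar`).

From a drawing to an order: a point of the outer face acts as an extra vertex joined to all others.
Nonplanarity of `K₃,₃` and `K₅` then excludes subdivisions of `K₂,₃` and crossing chords of a cycle.
Without the former, a nonseparable vertex set has a Hamiltonian cycle; without the latter, its
cyclic order is noncrossing. Other vertex sets are split at a cut vertex and the orders are glued
(`exists_isNoncrossingList`). Nonplanarity itself is a parity argument on winding numbers: disjoint
paths give an integer equation for every pair of independent edges, and the system has no solution.
-/

/-! ### Increments of the logarithm along paths -/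

/-- `z` is the increment of a continuous logarithm of `γ - a` along the path `γ`. -/
def IsLogIncrement (γ : unitInterval → ℂ) (a z : ℂ) : Prop :=
  ∃ g : unitInterval → ℂ, Continuous g ∧ (∀ t, Complex.exp (g t) = γ t - a) ∧ g 1 - g 0 = z

/-- The exponential is a covering map onto the nonzero complex numbers, so two lifts of one path
differ by the constant given by their initial values. -/
theorem IsLogIncrement.unique {γ : unitInterval → ℂ} {a z w : ℂ}
    (hz : IsLogIncrement γ a z) (hw : IsLogIncrement γ a w) : z = w := by
  obtain ⟨g, hg, hgγ, rfl⟩ := hz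
  obtain ⟨k, hk, hkγ, rfl⟩ := hw
  have key : g = fun t => k t + (g 0 - k 0) := by
    refine Complex.isCoveringMap_exp.eq_of_comp_eq hg (by fun_prop) ?_ 0 (by ring)
    funext t
    have h0 : Complex.exp (g 0 - k 0) = 1 := by
      rw [Complex.exp_sub, hgγ, hkγ]
      exact div_self (hkγ 0 ▸ Complex.exp_ne_zero _)
    simp only [Function.comp_apply, Subtype.mk.injEq]
    rw [Complex.exp_add, h0, hgγ, hkγ, mul_one]
  have h1 := congrFun key 1
  rw [h1]; ring

/-- A nowhere vanishing continuous function on the unit square has a continuous logarithm. -/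
theorem exists_continuous_log_square (F : unitInterval × unitInterval → ℂ) (hF : Continuous F)
    (h0 : ∀ x, F x ≠ 0) : ∃ g : unitInterval × unitInterval → ℂ, Continuous g ∧
      ∀ x, Complex.exp (g x) = F x := by
  have cov := Complex.isCoveringMap_exp
  let H : C(unitInterval × unitInterval, {z : ℂ // z ≠ 0}) :=
    ⟨fun x => ⟨F x, h0 x⟩, by fun_prop⟩
  let γ : C(unitInterval, {z : ℂ // z ≠ 0}) := ⟨fun t => ⟨F (0, t), h0 _⟩, by fun_prop⟩
  have hγ0 : γ 0 = ⟨_, (Complex.log (F (0, 0))).exp_ne_zero⟩ :=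
    Subtype.ext (Complex.exp_log (h0 _)).symm
  let f := cov.liftPath γ _ hγ0
  have hf : ∀ a, H (0, a) = ⟨_, (f a).exp_ne_zero⟩ := fun a =>
    (congrFun (cov.liftPath_lifts γ _ hγ0) a).symm
  refine ⟨cov.liftHomotopy H f hf, ContinuousMap.continuous _, fun x => ?_⟩
  exact congrArg Subtype.val (congrFun (cov.liftHomotopy_lifts H f hf) x)

/-- Disjoint paths have logarithmic increments as seen from each other's endpoints, and these
increments cancel around the square. -/
theorem exists_isLogIncrement_of_disjoint {e f : unitInterval → ℂ} (he : Continuous e)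
    (hf : Continuous f) (h : ∀ s t, e s ≠ f t) :
    ∃ z₀ z₁ w₀ w₁, IsLogIncrement f (e 0) z₀ ∧ IsLogIncrement f (e 1) z₁ ∧
      IsLogIncrement e (f 0) w₀ ∧ IsLogIncrement e (f 1) w₁ ∧ z₀ + w₁ - z₁ - w₀ = 0 := by
  -- The four increments are those of one logarithm of `f t - e s` along the sides of the square, so
  -- they telescope. On the sides where `e` moves the difference has the opposite sign, and adding
  -- `πi` corrects this without changing increments.
  obtain ⟨g, hg, hgF⟩ := exists_continuous_log_square (fun x => f x.2 - e x.1) (by fun_prop)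
    (fun x => sub_ne_zero.2 (h _ _).symm)
  have hexp : ∀ x, Complex.exp (g x + Real.pi * Complex.I) = e x.1 - f x.2 := fun x => by
    rw [Complex.exp_add, hgF, Complex.exp_pi_mul_I]; ring
  refine ⟨g (0, 1) - g (0, 0), g (1, 1) - g (1, 0), g (1, 0) - g (0, 0), g (1, 1) - g (0, 1),
    ⟨fun t => g (0, t), by fun_prop, fun t => hgF _, rfl⟩,
    ⟨fun t => g (1, t), by fun_prop, fun t => hgF _, rfl⟩,
    ⟨fun t => g (t, 0) + Real.pi * Complex.I, by fun_prop, fun t => hexp _, by ring⟩,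
    ⟨fun t => g (t, 1) + Real.pi * Complex.I, by fun_prop, fun t => hexp _, by ring⟩, by ring⟩

/-- A logarithm of the vector from the `i`-th to the `j`-th point, chosen so that exchanging the
indices adds `±πi`. -/
noncomputable def diffLog {m : ℕ} (p : Fin m → ℂ) (i j : Fin m) : ℂ :=
  if i < j then Complex.log (p j - p i) else Complex.log (p i - p j) + Real.pi * Complex.I

/-- The sign `1` or `-1` according to whether `i < j`. -/
def orderSign {m : ℕ} (i j : Fin m) : ℤ := if i < j then 1 else -1

theorem exp_diffLog {m : ℕ} {p : Fin m → ℂ} {i j : Fin m} (h : p i ≠ p j) :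
    Complex.exp (diffLog p i j) = p j - p i := by
  unfold diffLog
  split_ifs
  · exact Complex.exp_log (sub_ne_zero.2 h.symm)
  · rw [Complex.exp_add, Complex.exp_pi_mul_I, Complex.exp_log (sub_ne_zero.2 h)]; ring

theorem diffLog_sub_diffLog {m : ℕ} (p : Fin m → ℂ) {i j : Fin m} (h : i ≠ j) :
    diffLog p i j - diffLog p j i = -(orderSign i j * (Real.pi * Complex.I)) := by
  unfold diffLog orderSign
  rcases lt_or_gt_of_ne h with h | h <;> simp [h, h.not_gt]

/-- The endpoints determine the increment modulo `2πi`; the integer measures the winding of the path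
against the fixed reference logarithms `diffLog`. -/
theorem IsLogIncrement.exists_int {m : ℕ} {p : Fin m → ℂ} {a c d : Fin m}
    {γ : unitInterval → ℂ} {z : ℂ} (hz : IsLogIncrement γ (p a) z) (h0 : γ 0 = p c)
    (h1 : γ 1 = p d) :
    ∃ n : ℤ, z = diffLog p a d - diffLog p a c + n * (2 * Real.pi * Complex.I) := by
  obtain ⟨g, -, hg, rfl⟩ := hz
  have hc : p a ≠ p c := fun h => Complex.exp_ne_zero (g 0) (by rw [hg, h0, h, sub_self])
  have hd : p a ≠ p d := fun h => Complex.exp_ne_zero (g 1) (by rw [hg, h1, h, sub_self])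
  obtain ⟨k, hk⟩ := Complex.exp_eq_exp_iff_exists_int.1
    ((hg 0).trans ((congrArg (· - p a) h0).trans (exp_diffLog hc).symm))
  obtain ⟨l, hl⟩ := Complex.exp_eq_exp_iff_exists_int.1
    ((hg 1).trans ((congrArg (· - p a) h1).trans (exp_diffLog hd).symm))
  exact ⟨l - k, by rw [hk, hl]; push_cast; ring⟩

/-- In a drawing of a graph in which independent edges are disjoint, the integer defects of the
logarithmic increments satisfy one equation for every pair of independent edges. -/
theorem exists_winding_defects {m : ℕ} (p : Fin m → ℂ) (E : Fin m → Fin m → Prop)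
    (γ : Fin m → Fin m → unitInterval → ℂ)
    (hγ : ∀ a b, E a b → Continuous (γ a b) ∧ γ a b 0 = p a ∧ γ a b 1 = p b)
    (hd : ∀ a b c d, E a b → E c d → a ≠ c → a ≠ d → b ≠ c → b ≠ d →
      ∀ s t, γ a b s ≠ γ c d t) :
    ∃ n : Fin m → Fin m → Fin m → ℤ, ∀ a b c d, E a b → E c d → a ≠ c → a ≠ d → b ≠ c → b ≠ d →
      2 * (n a c d + n d a b - n b c d - n c a b) =
        orderSign a d - orderSign a c + orderSign d b + orderSign b c := by
  have hn : ∀ a c d, ∃ n : ℤ, E c d → ∀ z, IsLogIncrement (γ c d) (p a) z →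
      z = diffLog p a d - diffLog p a c + n * (2 * Real.pi * Complex.I) := by
    intro a c d
    -- One integer must serve every equation containing this point and path, which uniqueness of the
    -- increment permits; without an increment the value `0` is vacuous.
    by_cases h : E c d ∧ ∃ z, IsLogIncrement (γ c d) (p a) z
    · obtain ⟨hE, z, hz⟩ := h
      obtain ⟨n, hn⟩ := hz.exists_int (hγ c d hE).2.1 (hγ c d hE).2.2
      exact ⟨n, fun _ w hw => hw.unique hz ▸ hn⟩
    · exact ⟨0, fun hE z hz => (h ⟨hE, z, hz⟩).elim⟩
  choose n hn using hn
  refine ⟨n, fun a b c d hab hcd hac had hbc hbd => ?_⟩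
  obtain ⟨ca, a0, b1⟩ := hγ a b hab
  obtain ⟨cc, c0, d1⟩ := hγ c d hcd
  obtain ⟨z₀, z₁, w₀, w₁, hz₀, hz₁, hw₀, hw₁, hsum⟩ :=
    exists_isLogIncrement_of_disjoint ca cc (hd a b c d hab hcd hac had hbc hbd)
  rw [a0] at hz₀
  rw [b1] at hz₁
  rw [c0] at hw₀
  rw [d1] at hw₁
  rw [hn a c d hcd _ hz₀, hn b c d hcd _ hz₁, hn c a b hab _ hw₀, hn d a b hab _ hw₁] at hsum
  have e1 := diffLog_sub_diffLog p had
  have e2 := diffLog_sub_diffLog p hac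
  have e3 := diffLog_sub_diffLog p hbd.symm
  have e4 := diffLog_sub_diffLog p hbc
  have hpi : (Real.pi : ℂ) * Complex.I ≠ 0 :=
    mul_ne_zero (by exact_mod_cast Real.pi_ne_zero) Complex.I_ne_zero
  have : ((2 * (n a c d + n d a b - n b c d - n c a b) : ℤ) : ℂ) =
      ((orderSign a d - orderSign a c + orderSign d b + orderSign b c : ℤ) : ℂ) := by
    refine mul_right_cancel₀ hpi ?_
    push_cast
    linear_combination hsum - e1 + e2 - e3 - e4
  exact_mod_cast this

/-! ### The graphs `K₅` and `K₃,₃` -/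

theorem JoinedIn.exists_path_fun {X : Type*} [TopologicalSpace X] {S : Set X} {x y : X}
    (h : JoinedIn S x y) : ∃ γ : unitInterval → X, Continuous γ ∧ γ 0 = x ∧ γ 1 = y ∧
      ∀ t, γ t ∈ S :=
  ⟨h.somePath, h.somePath.continuous, h.somePath.source, h.somePath.target, h.somePath_mem⟩

/-- `K₅` has no drawing in the plane in which independent edges are disjoint. -/
theorem completeGraph_five_not_drawable (p : Fin 5 → ℂ) (T : Fin 5 → Fin 5 → Set ℂ)
    (hT : ∀ i j, i < j → JoinedIn (T i j) (p i) (p j))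
    (hd : ∀ a b c d, a < b → c < d → a < c → b ≠ c → b ≠ d → Disjoint (T a b) (T c d)) :
    False := by
  have h : ∀ i j, ∃ γ : unitInterval → ℂ, i < j → Continuous γ ∧ γ 0 = p i ∧ γ 1 = p j ∧
      ∀ t, γ t ∈ T i j := fun i j => by
    by_cases hij : i < j
    · obtain ⟨γ, hγ⟩ := (hT i j hij).exists_path_fun
      exact ⟨γ, fun _ => hγ⟩
    · exact ⟨fun _ => 0, fun h => (hij h).elim⟩
  choose γ hγ using h
  obtain ⟨n, hn⟩ := exists_winding_defects p (fun i j => i < j) γ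
    (fun a b h => ⟨(hγ a b h).1, (hγ a b h).2.1, (hγ a b h).2.2.1⟩) (by
      intro a b c d hab hcd hac had hbc hbd s t he
      rcases lt_or_gt_of_ne hac with h | h
      · exact Set.disjoint_left.1 (hd a b c d hab hcd h hbc hbd) ((hγ a b hab).2.2.2 s)
          (he ▸ (hγ c d hcd).2.2.2 t)
      · exact Set.disjoint_left.1 (hd c d a b hcd hab h had.symm hbd.symm)
          ((hγ c d hcd).2.2.2 t) (he ▸ (hγ a b hab).2.2.2 s))
  have key : ∀ a b c d : Fin 5, a < b ∧ c < d ∧ a < c ∧ b ≠ c ∧ b ≠ d →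
      2 * (n a c d + n d a b - n b c d - n c a b) =
        orderSign a d - orderSign a c + orderSign d b + orderSign b c :=
    fun a b c d ⟨h1, h2, h3, h4, h5⟩ => hn a b c d h1 h2 h3.ne (h3.trans h2).ne h4 h5
  -- All 15 pairs of independent edges. Divided by two and summed modulo 2, the left sides cancel,
  -- since each unknown occurs in exactly two equations. The right side is odd exactly for
  -- interleaved pairs, one for each of the five 4-element subsets, so the total is odd.
  have := key 0 1 2 3 (by decide)
  have := key 0 1 2 4 (by decide)
  have := key 0 1 3 4 (by decide)
  have := key 0 2 1 3 (by decide)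
  have := key 0 2 1 4 (by decide)
  have := key 0 2 3 4 (by decide)
  have := key 0 3 1 2 (by decide)
  have := key 0 3 1 4 (by decide)
  have := key 0 3 2 4 (by decide)
  have := key 0 4 1 2 (by decide)
  have := key 0 4 1 3 (by decide)
  have := key 0 4 2 3 (by decide)
  have := key 1 2 3 4 (by decide)
  have := key 1 3 2 4 (by decide)
  have := key 1 4 2 3 (by decide)
  simp [orderSign] at *
  omega

/-- `K₃,₃` has no drawing in the plane in which independent edges are disjoint. -/
theorem completeBipartite_three_not_drawable (p q : Fin 3 → ℂ) (T : Fin 3 → Fin 3 → Set ℂ)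
    (hT : ∀ i j, JoinedIn (T i j) (p i) (q j))
    (hd : ∀ i j k l, i < k → j ≠ l → Disjoint (T i j) (T k l)) : False := by
  choose γ hγ using fun i j => (hT i j).exists_path_fun
  have hγd : ∀ i j k l, i ≠ k → j ≠ l → ∀ s t, γ i j s ≠ γ k l t := by
    intro i j k l hik hjl s t he
    rcases lt_or_gt_of_ne hik with h | h
    · exact Set.disjoint_left.1 (hd i j k l h hjl) ((hγ i j).2.2.2 s) (he ▸ (hγ k l).2.2.2 t)
    · exact Set.disjoint_left.1 (hd k l i j h hjl.symm) ((hγ k l).2.2.2 t)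
        (he ▸ (hγ i j).2.2.2 s)
  obtain ⟨n, hn⟩ := exists_winding_defects (m := 3 + 3) (Fin.append p q)
    (fun a b => ∃ i j, a = Fin.castAdd 3 i ∧ b = Fin.natAdd 3 j)
    (fun a b => Fin.append (m := 3) (n := 3) (fun i => Fin.append (m := 3) (n := 3)
      (fun _ _ => 0) (fun j => γ i j) b) (fun _ _ => 0) a) (by
      rintro _ _ ⟨i, j, rfl, rfl⟩
      simp only [Fin.append_left, Fin.append_right]
      exact ⟨(hγ i j).1, (hγ i j).2.1, (hγ i j).2.2.1⟩) (by
      rintro _ _ _ _ ⟨i, j, rfl, rfl⟩ ⟨k, l, rfl, rfl⟩ hik - - hjl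
      simp only [Fin.append_left, Fin.append_right]
      exact hγd i j k l (fun h => hik (h ▸ rfl)) (fun h => hjl (h ▸ rfl)))
  have key : ∀ i j k l : Fin 3, i ≠ k ∧ j ≠ l →
      2 * (n (i.castAdd 3) (k.castAdd 3) (l.natAdd 3) + n (l.natAdd 3) (i.castAdd 3) (j.natAdd 3)
        - n (j.natAdd 3) (k.castAdd 3) (l.natAdd 3) - n (k.castAdd 3) (i.castAdd 3) (j.natAdd 3)) =
      1 - orderSign i k + orderSign l j - 1 := fun i j k l ⟨hik, hjl⟩ => by
    have := hn (i.castAdd 3) (j.natAdd 3) (k.castAdd 3) (l.natAdd 3) ⟨i, j, rfl, rfl⟩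
      ⟨k, l, rfl, rfl⟩ (fun h => hik (Fin.castAdd_injective 3 3 h))
      (by simp [Fin.ext_iff]; omega) (by simp [Fin.ext_iff]; omega) (fun h => hjl (Fin.natAdd_injective 3 3 h))
    rw [this]
    simp only [orderSign, Fin.lt_def, Fin.val_castAdd, Fin.val_natAdd]
    split_ifs <;> omega
  -- The same parity count: each unknown occurs twice among the 18 equations, and the halved right
  -- side is odd for the nine pairs with `i < k` and `j < l`.
  have k1 := key 0 0 1 1 (by decide)
  have k2 := key 0 0 1 2 (by decide)
  have k3 := key 0 0 2 1 (by decide)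
  have k4 := key 0 0 2 2 (by decide)
  have k5 := key 0 1 1 0 (by decide)
  have k6 := key 0 1 1 2 (by decide)
  have k7 := key 0 1 2 0 (by decide)
  have k8 := key 0 1 2 2 (by decide)
  have k9 := key 0 2 1 0 (by decide)
  have k10 := key 0 2 1 1 (by decide)
  have k11 := key 0 2 2 0 (by decide)
  have k12 := key 0 2 2 1 (by decide)
  have k13 := key 1 0 2 1 (by decide)
  have k14 := key 1 0 2 2 (by decide)
  have k15 := key 1 1 2 0 (by decide)
  have k16 := key 1 1 2 2 (by decide)
  have k17 := key 1 2 2 0 (by decide)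
  have k18 := key 1 2 2 1 (by decide)
  clear key hn hγ hγd hd hT
  simp [orderSign] at k1 k2 k3 k4 k5 k6 k7 k8 k9 k10 k11 k12 k13 k14 k15 k16 k17 k18
  omega

/-! ### Plane drawings -/

theorem completeGraph_five_not_drawable_prod (p : Fin 5 → ℝ × ℝ)
    (T : Fin 5 → Fin 5 → Set (ℝ × ℝ)) (hT : ∀ i j, i < j → JoinedIn (T i j) (p i) (p j))
    (hd : ∀ a b c d, a < b → c < d → a < c → b ≠ c → b ≠ d → Disjoint (T a b) (T c d)) :
    False :=
  completeGraph_five_not_drawable (fun i => Complex.equivRealProdCLM.symm (p i))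
    (fun i j => Complex.equivRealProdCLM.symm '' T i j)
    (fun i j h => (hT i j h).map Complex.equivRealProdCLM.symm.continuous)
    (fun a b c d h1 h2 h3 h4 h5 => (hd a b c d h1 h2 h3 h4 h5).image
      (Complex.equivRealProdCLM.symm.injective.injOn (s := Set.univ)) (Set.subset_univ _)
      (Set.subset_univ _))

theorem completeBipartite_three_not_drawable_prod (p q : Fin 3 → ℝ × ℝ)
    (T : Fin 3 → Fin 3 → Set (ℝ × ℝ)) (hT : ∀ i j, JoinedIn (T i j) (p i) (q j))
    (hd : ∀ i j k l, i < k → j ≠ l → Disjoint (T i j) (T k l)) : False :=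
  completeBipartite_three_not_drawable (fun i => Complex.equivRealProdCLM.symm (p i))
    (fun i => Complex.equivRealProdCLM.symm (q i))
    (fun i j => Complex.equivRealProdCLM.symm '' T i j)
    (fun i j => (hT i j).map Complex.equivRealProdCLM.symm.continuous)
    (fun a b c d h1 h2 => (hd a b c d h1 h2).image
      (Complex.equivRealProdCLM.symm.injective.injOn (s := Set.univ)) (Set.subset_univ _)
      (Set.subset_univ _))

/-- Two vertices are joined by a walk all of whose vertices lie in `S`. -/
def WalkIn {V : Type*} (G : SimpleGraph V) (S : Set V) (a b : V) : Prop :=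
  ∃ w : G.Walk a b, ∀ v ∈ w.support, v ∈ S

/-- Move both points radially outward to a common sphere, which is path connected in dimension two.
-/
theorem exists_joinedIn_compl_closedBall {R : ℝ} (hR : 0 ≤ R) {x y : ℝ × ℝ} (hx : R < ‖x‖)
    (hy : R < ‖y‖) : JoinedIn (Metric.closedBall (0 : ℝ × ℝ) R)ᶜ x y := by
  have scale : ∀ z : ℝ × ℝ, R < ‖z‖ → ∀ c : ℝ, 1 ≤ c →
      JoinedIn (Metric.closedBall (0 : ℝ × ℝ) R)ᶜ z (c • z) := by
    intro z hz c hc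
    refine JoinedIn.of_segment_subset ?_
    rintro _ ⟨a, b, ha, hb, hab, rfl⟩
    have : a • z + b • c • z = (a + b * c) • z := by rw [add_smul, mul_smul]
    simp only [Set.mem_compl_iff, Metric.mem_closedBall, dist_zero_right, not_le]
    rw [this, norm_smul, Real.norm_eq_abs]
    have h1 : 1 ≤ a + b * c := by nlinarith
    rw [abs_of_nonneg (by linarith)]
    nlinarith [norm_nonneg z]
  have hrank : 1 < Module.rank ℝ (ℝ × ℝ) := by
    rw [rank_prod', Module.rank_self, one_add_one_eq_two]; exact Cardinal.one_lt_two
  have hx0 : 0 < ‖x‖ := hR.trans_lt hx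
  have hy0 : 0 < ‖y‖ := hR.trans_lt hy
  set M := max ‖x‖ ‖y‖ with hM
  have hM0 : 0 ≤ M := hx0.le.trans (le_max_left _ _)
  have hsphere := (isPathConnected_sphere hrank (0 : ℝ × ℝ) hM0).joinedIn
    ((M / ‖x‖) • x) (by simp [norm_smul, hx0.ne', hM0])
    ((M / ‖y‖) • y) (by simp [norm_smul, hy0.ne', hM0])
  have hsub : Metric.sphere (0 : ℝ × ℝ) M ⊆ (Metric.closedBall (0 : ℝ × ℝ) R)ᶜ := by
    intro z hz
    simp only [mem_sphere_iff_norm, sub_zero] at hz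
    have hRM : R < M := hx.trans_le (le_max_left _ _)
    simpa [hz] using hRM
  exact ((scale x hx _ ((one_le_div hx0).2 (le_max_left _ _))).trans (hsphere.mono hsub)).trans
    (scale y hy _ ((one_le_div hy0).2 (le_max_right _ _))).symm

namespace PlaneDrawing

variable {V : Type*} {G : SimpleGraph V} (D : PlaneDrawing G)

/-- The part of a drawing spanned by the vertices in `S`. -/
def region (S : Set V) : Set (ℝ × ℝ) :=
  D.point '' S ∪ ⋃ e ∈ {e : G.edgeSet | ∀ v ∈ (e : Sym2 V), v ∈ S}, Set.range (D.arc e)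

theorem region_subset_support (S : Set V) : D.region S ⊆ D.support := by
  refine Set.union_subset_union (Set.image_subset_range _ _) ?_
  exact Set.iUnion₂_subset fun e _ => Set.subset_iUnion (fun e => Set.range (D.arc e)) e

theorem region_mono {S T : Set V} (h : S ⊆ T) : D.region S ⊆ D.region T :=
  Set.union_subset_union (Set.image_mono h)
    (Set.biUnion_subset_biUnion_left fun _ he v hv => h (he v hv))

theorem exists_endpoint (e : G.edgeSet) :
    (∃ v ∈ (e : Sym2 V), D.arc e 0 = D.point v) ∧ ∃ v ∈ (e : Sym2 V), D.arc e 1 = D.point v := by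
  have h := D.arc_endpoints e
  have h0 : D.arc e 0 ∈ (e : Sym2 V).map D.point := h ▸ Sym2.mem_mk_left _ _
  have h1 : D.arc e 1 ∈ (e : Sym2 V).map D.point := h ▸ Sym2.mem_mk_right _ _
  obtain ⟨v, hv, hv'⟩ := Sym2.mem_map.1 h0
  obtain ⟨w, hw, hw'⟩ := Sym2.mem_map.1 h1
  exact ⟨⟨v, hv, hv'.symm⟩, ⟨w, hw, hw'.symm⟩⟩

theorem arc_endpoint_or (e : G.edgeSet) (t : unitInterval) :
    (0 < t ∧ t < 1) ∨ ∃ v ∈ (e : Sym2 V), D.arc e t = D.point v := by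
  obtain ⟨h0, h1⟩ := D.exists_endpoint e
  rcases eq_or_ne t 0 with rfl | ht0
  · exact Or.inr h0
  rcases eq_or_ne t 1 with rfl | ht1
  · exact Or.inr h1
  exact Or.inl ⟨unitInterval.pos_iff_ne_zero.2 ht0, unitInterval.lt_one_iff_ne_one.2 ht1⟩

theorem arc_ne_point_of_notMem {e : G.edgeSet} {v : V} (h : v ∉ (e : Sym2 V))
    (t : unitInterval) : D.arc e t ≠ D.point v := by
  rcases D.arc_endpoint_or e t with ⟨h0, h1⟩ | ⟨w, hw, hwt⟩
  · exact D.arc_ne_point e t h0 h1 v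
  · rw [hwt]
    exact fun hwv => h (D.point_injective hwv ▸ hw)

theorem point_mem_region_iff {S : Set V} {v : V} : D.point v ∈ D.region S ↔ v ∈ S := by
  refine ⟨?_, fun h => Or.inl ⟨v, h, rfl⟩⟩
  rintro (⟨w, hw, h⟩ | h)
  · exact D.point_injective h ▸ hw
  · simp only [Set.mem_iUnion, Set.mem_range] at h
    obtain ⟨e, he, t, ht⟩ := h
    by_contra hv
    exact D.arc_ne_point_of_notMem (fun h => hv (he v h)) t ht

/-- Arcs of a drawing meet only in common endpoints. This reduces disjointness in the plane to
disjointness of vertex sets. -/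
theorem region_disjoint {S T : Set V} (h : Disjoint S T) : Disjoint (D.region S) (D.region T) := by
  have hST : ∀ v, v ∈ S → v ∉ T := fun v hv => Set.disjoint_left.1 h hv
  refine Set.disjoint_left.2 fun z hS hT => ?_
  have hz := hS
  rcases hS with ⟨v, hv, rfl⟩ | hS
  · exact hST v hv (D.point_mem_region_iff.1 hT)
  rcases hT with ⟨v, hv, rfl⟩ | hT
  · exact hST v (D.point_mem_region_iff.1 hz) hv
  simp only [Set.mem_iUnion, Set.mem_range] at hS hT
  obtain ⟨e, he, t, rfl⟩ := hS
  obtain ⟨f, hf, s, hs⟩ := hT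
  rcases D.arc_endpoint_or e t with ⟨h0, h1⟩ | ⟨w, hw, hwt⟩
  · refine D.arc_ne_arc e f ?_ t s h0 h1 hs.symm
    rintro rfl
    obtain ⟨⟨v, hv, -⟩, -⟩ := D.exists_endpoint e
    exact hST v (he v hv) (hf v hv)
  · exact D.arc_ne_point_of_notMem (fun h => hST w (he w hw) (hf w h)) s (hs.trans hwt)

theorem joinedIn_region_of_adj {S : Set V} {a b : V} (h : G.Adj a b) (ha : a ∈ S) (hb : b ∈ S) :
    JoinedIn (D.region S) (D.point a) (D.point b) := by
  let e : G.edgeSet := ⟨s(a, b), h⟩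
  have hj : JoinedIn (D.region S) (D.arc e 0) (D.arc e 1) :=
    ⟨⟨⟨D.arc e, D.arc_continuous e⟩, rfl, rfl⟩, fun t => Or.inr (by
      simp only [Set.mem_iUnion, Set.mem_range]
      refine ⟨e, ?_, t, rfl⟩
      intro v hv
      rcases Sym2.mem_iff.1 hv with rfl | rfl <;> assumption)⟩
  have he := D.arc_endpoints e
  simp only [e, Sym2.map_mk, Sym2.eq_iff] at he
  rcases he with ⟨h0, h1⟩ | ⟨h0, h1⟩
  · rwa [← h0, ← h1]
  · rw [← h0, ← h1]; exact hj.symm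

theorem joinedIn_region {S : Set V} {a b : V} (h : WalkIn G S a b) :
    JoinedIn (D.region S) (D.point a) (D.point b) := by
  obtain ⟨w, hw⟩ := h
  induction w with
  | nil => exact JoinedIn.refl (D.point_mem_region_iff.2 (hw _ (by simp)))
  | @cons u v x h w ih =>
    exact (D.joinedIn_region_of_adj h (hw u (by simp)) (hw v (by simp))).trans
      (ih fun y hy => hw y (by simp [hy]))

variable [Finite V]

theorem isCompact_region (S : Set V) : IsCompact (D.region S) := by
  refine (Set.toFinite _).isCompact.union ?_
  exact (Set.toFinite _).isCompact_biUnion fun e _ => isCompact_range (D.arc_continuous e)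

theorem isCompact_support : IsCompact D.support :=
  (Set.finite_range _).isCompact.union
    (isCompact_iUnion fun e => isCompact_range (D.arc_continuous e))

/-- The drawing is compact, so an unbounded component of its complement leaves a ball containing the
drawing, and outside that ball any two points can be joined. -/
theorem joinedIn_compl_support {x y : ℝ × ℝ} (hx : x ∈ D.outerFace) (hy : y ∈ D.outerFace) :
    JoinedIn D.supportᶜ x y := by
  obtain ⟨R, hR0, hR⟩ := D.isCompact_support.isBounded.subset_closedBall_lt 0 0
  have far : ∀ z ∈ D.outerFace, ∃ z', R < ‖z'‖ ∧ JoinedIn D.supportᶜ z z' := by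
    rintro z ⟨hz, hzu⟩
    have : ∃ z' ∈ connectedComponentIn D.supportᶜ z, R < ‖z'‖ := by
      by_contra! h
      exact hzu ((Metric.isBounded_closedBall (x := (0 : ℝ × ℝ)) (r := R)).subset
        fun w hw => by simpa using h w hw)
    obtain ⟨z', hz', hn⟩ := this
    have hopen : IsOpen (connectedComponentIn D.supportᶜ z) :=
      D.isCompact_support.isClosed.isOpen_compl.connectedComponentIn
    have hconn : IsConnected (connectedComponentIn D.supportᶜ z) :=
      isConnected_connectedComponentIn_iff.2 hz
    exact ⟨z', hn, ((hopen.isConnected_iff_isPathConnected.1 hconn).joinedIn z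
      (mem_connectedComponentIn hz) z' hz').mono (connectedComponentIn_subset _ _)⟩
  obtain ⟨x', hx', jx⟩ := far x hx
  obtain ⟨y', hy', jy⟩ := far y hy
  exact (jx.trans ((exists_joinedIn_compl_closedBall hR0.le hx' hy').mono
    (Set.compl_subset_compl.2 hR))).trans jy.symm

/-- The edge from the extra vertex `ω` to `v`. Its last piece is a straight segment in a small ball
and may cross arcs ending at `v`, so it is only known to avoid the drawing of the other vertices.
This suffices because the nonplanarity lemmas ask for disjointness of independent edges only. -/
theorem joinedIn_outer {ω : ℝ × ℝ} (hω : ω ∈ D.outerFace) {v : V}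
    (hv : D.point v ∈ frontier D.outerFace) :
    JoinedIn (D.region {v}ᶜ)ᶜ ω (D.point v) := by
  have hopen : IsOpen (D.region {v}ᶜ)ᶜ := (D.isCompact_region _).isClosed.isOpen_compl
  obtain ⟨ε, hε, hball⟩ := Metric.isOpen_iff.1 hopen (D.point v) (by
    rw [Set.mem_compl_iff, point_mem_region_iff]; simp)
  obtain ⟨z, hz, hzv⟩ := Metric.mem_closure_iff.1 hv.1 ε hε
  refine ((D.joinedIn_compl_support hω hz).mono
    (Set.compl_subset_compl.2 (D.region_subset_support _))).trans ?_
  refine JoinedIn.of_segment_subset (((convex_ball (D.point v) ε).segment_subset ?_ ?_).trans hball)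
  · rwa [Metric.mem_ball, dist_comm]
  · exact Metric.mem_ball_self hε

omit [Finite V] in
theorem disjoint_outer {S : Set V} {v : V} (h : v ∉ S) :
    Disjoint (D.region {v}ᶜ)ᶜ (D.region S) :=
  Set.disjoint_compl_left_iff_subset.2
    (D.region_mono fun w hw => by rintro rfl; exact h hw)

omit [Finite V] in
theorem exists_mem_outerFace {v : V} (hv : D.point v ∈ frontier D.outerFace) :
    ∃ ω, ω ∈ D.outerFace :=
  closure_nonempty_iff.1 ⟨_, hv.1⟩

/-- An outerplanar graph contains no subdivision of `K₂,₃`. -/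
theorem no_theta (hD : ∀ v, D.point v ∈ frontier D.outerFace) {c d : V} (hcd : c ≠ d)
    (A : Fin 3 → Set V) (r : Fin 3 → V) (hr : ∀ j, r j ∈ A j)
    (hA : ∀ j k, j ≠ k → Disjoint (A j) (A k)) (hc : ∀ j, c ∉ A j) (hd : ∀ j, d ∉ A j)
    (hwc : ∀ j, WalkIn G (insert c (A j)) c (r j))
    (hwd : ∀ j, WalkIn G (insert d (A j)) d (r j)) : False := by
  obtain ⟨ω, hω⟩ := D.exists_mem_outerFace (hD c)
  have hrA : ∀ j l, j ≠ l → r j ∉ A l := fun j l h => Set.disjoint_left.1 (hA j l h) (hr j)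
  have hrc : ∀ j, r j ≠ c := fun j h => hc j (h ▸ hr j)
  have hrd : ∀ j, r j ≠ d := fun j h => hd j (h ▸ hr j)
  -- With `ω` as a third branch vertex beside `c` and `d`, the theta becomes a `K₃,₃`.
  refine completeBipartite_three_not_drawable_prod ![ω, D.point c, D.point d]
    (fun j => D.point (r j))
    (fun i j => ![(D.region {r j}ᶜ)ᶜ, D.region (insert c (A j)), D.region (insert d (A j))] i) ?_ ?_
  · intro i j
    fin_cases i
    · exact D.joinedIn_outer hω (hD _)
    · exact D.joinedIn_region (hwc j)
    · exact D.joinedIn_region (hwd j)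
  · intro i j k l hik hjl
    have : (i, k) = (0, 1) ∨ (i, k) = (0, 2) ∨ (i, k) = (1, 2) := by
      revert i k; decide
    simp only [Prod.mk.injEq] at this
    rcases this with ⟨rfl, rfl⟩ | ⟨rfl, rfl⟩ | ⟨rfl, rfl⟩
    · exact D.disjoint_outer (by simp [hrA j l hjl, hrc])
    · exact D.disjoint_outer (by simp [hrA j l hjl, hrd])
    · refine D.region_disjoint ?_
      simp only [Set.disjoint_insert_left, Set.disjoint_insert_right, Set.mem_insert_iff]
      exact ⟨fun h => h.elim hcd.symm (hd j), hc l, hA j l hjl⟩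

/-- A cycle of an outerplanar graph has no crossing chords. -/
theorem no_crossing_chords (hD : ∀ v, D.point v ∈ frontier D.outerFace) {u w v x : V}
    (huv : G.Adj u v) (hwx : G.Adj w x) {A B C E : Set V}
    (hA : WalkIn G A u w) (hB : WalkIn G B w v) (hC : WalkIn G C v x) (hE : WalkIn G E x u)
    (hAC : Disjoint A C) (hBE : Disjoint B E) (huB : u ∉ B) (huC : u ∉ C) (hwC : w ∉ C)
    (hwE : w ∉ E) (hvE : v ∉ E) (hvA : v ∉ A) (hxA : x ∉ A) (hxB : x ∉ B) : False := by
  obtain ⟨ω, hω⟩ := D.exists_mem_outerFace (hD u)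
  have left : ∀ {S : Set V} {a b : V}, WalkIn G S a b → a ∈ S := fun ⟨w, hw⟩ =>
    hw _ w.start_mem_support
  have huA := left hA
  have hwB := left hB
  have hvC := left hC
  have hxE := left hE
  have huw : u ≠ w := by rintro rfl; exact huB hwB
  have hux : u ≠ x := by rintro rfl; exact hxA huA
  have hvw : v ≠ w := by rintro rfl; exact hwC hvC
  have hvx : v ≠ x := by rintro rfl; exact hvE hxE
  -- A `K₅` on `ω` and the four vertices: four edges run to `ω`, four are the arcs of the cycle, and
  -- two are the chords.
  refine completeGraph_five_not_drawable_prod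
    ![ω, D.point u, D.point w, D.point v, D.point x]
    (fun i j => ![![∅, (D.region {u}ᶜ)ᶜ, (D.region {w}ᶜ)ᶜ, (D.region {v}ᶜ)ᶜ, (D.region {x}ᶜ)ᶜ],
      ![∅, ∅, D.region A, D.region {u, v}, D.region E],
      ![∅, ∅, ∅, D.region B, D.region {w, x}],
      ![∅, ∅, ∅, ∅, D.region C], ![∅, ∅, ∅, ∅, ∅]] i j) ?_ ?_
  · intro i j hij
    have : (i, j) ∈ [((0 : Fin 5), (1 : Fin 5)), (0, 2), (0, 3), (0, 4), (1, 2), (1, 3), (1, 4),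
        (2, 3), (2, 4), (3, 4)] := by
      revert i j; decide
    simp only [List.mem_cons, Prod.mk.injEq, List.not_mem_nil, or_false] at this
    rcases this with ⟨rfl, rfl⟩ | ⟨rfl, rfl⟩ | ⟨rfl, rfl⟩ | ⟨rfl, rfl⟩ | ⟨rfl, rfl⟩ | ⟨rfl, rfl⟩ |
      ⟨rfl, rfl⟩ | ⟨rfl, rfl⟩ | ⟨rfl, rfl⟩ | ⟨rfl, rfl⟩
    · exact D.joinedIn_outer hω (hD _)
    · exact D.joinedIn_outer hω (hD _)
    · exact D.joinedIn_outer hω (hD _)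
    · exact D.joinedIn_outer hω (hD _)
    · exact D.joinedIn_region hA
    · exact D.joinedIn_region_of_adj huv (by simp) (by simp)
    · exact (D.joinedIn_region hE).symm
    · exact D.joinedIn_region hB
    · exact D.joinedIn_region_of_adj hwx (by simp) (by simp)
    · exact D.joinedIn_region hC
  · intro a b c d hab hcd hac hbc hbd
    have : (a, b, c, d) ∈ [((0 : Fin 5), (1 : Fin 5), (2 : Fin 5), (3 : Fin 5)), (0, 1, 2, 4),
        (0, 1, 3, 4), (0, 2, 1, 3), (0, 2, 1, 4), (0, 2, 3, 4), (0, 3, 1, 2), (0, 3, 1, 4),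
        (0, 3, 2, 4), (0, 4, 1, 2), (0, 4, 1, 3), (0, 4, 2, 3), (1, 2, 3, 4), (1, 3, 2, 4),
        (1, 4, 2, 3)] := by
      revert a b c d; decide
    simp only [List.mem_cons, Prod.mk.injEq, List.not_mem_nil, or_false] at this
    rcases this with ⟨rfl, rfl, rfl, rfl⟩ | ⟨rfl, rfl, rfl, rfl⟩ | ⟨rfl, rfl, rfl, rfl⟩ |
      ⟨rfl, rfl, rfl, rfl⟩ | ⟨rfl, rfl, rfl, rfl⟩ | ⟨rfl, rfl, rfl, rfl⟩ | ⟨rfl, rfl, rfl, rfl⟩ |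
      ⟨rfl, rfl, rfl, rfl⟩ | ⟨rfl, rfl, rfl, rfl⟩ | ⟨rfl, rfl, rfl, rfl⟩ | ⟨rfl, rfl, rfl, rfl⟩ |
      ⟨rfl, rfl, rfl, rfl⟩ | ⟨rfl, rfl, rfl, rfl⟩ | ⟨rfl, rfl, rfl, rfl⟩ | ⟨rfl, rfl, rfl, rfl⟩
    · exact D.disjoint_outer huB
    · exact D.disjoint_outer (by simp [huw, hux])
    · exact D.disjoint_outer huC
    · exact D.disjoint_outer (by simp [huw.symm, hvw.symm])
    · exact D.disjoint_outer hwE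
    · exact D.disjoint_outer hwC
    · exact D.disjoint_outer hvA
    · exact D.disjoint_outer hvE
    · exact D.disjoint_outer (by simp [hvw, hvx])
    · exact D.disjoint_outer hxA
    · exact D.disjoint_outer (by simp [hux.symm, hvx.symm])
    · exact D.disjoint_outer hxB
    · exact D.region_disjoint hAC
    · refine D.region_disjoint ?_
      simp [huw.symm, hux.symm, hvw.symm, hvx.symm]
    · exact D.region_disjoint hBE.symm

end PlaneDrawing

/-! ### Noncrossing orders -/

/-- The ordering of the vertices by the injective function `f` has no two edges that cross when
the vertices are placed on the boundary of a half-plane in this order. -/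
structure IsNoncrossingOrder {V α : Type*} [LinearOrder α] (G : SimpleGraph V) (f : V → α) :
    Prop where
  injective : Function.Injective f
  not_adj : ∀ u w v x, f u < f w → f w < f v → f v < f x → G.Adj u v → ¬ G.Adj w x

/-- The list version of `IsNoncrossingOrder`. -/
def IsNoncrossingList {V : Type*} (G : SimpleGraph V) (L : List V) : Prop :=
  ∀ u w v x, [u, w, v, x].Sublist L → G.Adj u v → ¬ G.Adj w x

/-- The vertices `a :: l` form a cycle in this order; a single edge counts as a cycle. -/
def IsCycleList {V : Type*} (G : SimpleGraph V) (a : V) (l : List V) : Prop :=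
  (a :: l).Nodup ∧ (a :: (l ++ [a])).IsChain G.Adj

/-! ### Walks, and lists read as cyclic orders -/

section Lists

variable {V : Type*} {G : SimpleGraph V}

theorem WalkIn.symm {S : Set V} {a b : V} (h : WalkIn G S a b) : WalkIn G S b a := by
  obtain ⟨w, hw⟩ := h
  exact ⟨w.reverse, by simpa using hw⟩

theorem WalkIn.trans {S : Set V} {a b c : V} (h : WalkIn G S a b) (h' : WalkIn G S b c) :
    WalkIn G S a c := by
  obtain ⟨w, hw⟩ := h
  obtain ⟨w', hw'⟩ := h'
  refine ⟨w.append w', fun v hv => ?_⟩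
  rcases SimpleGraph.Walk.mem_support_append_iff _ _ |>.1 hv with h | h
  exacts [hw v h, hw' v h]

theorem WalkIn.mono {S T : Set V} {a b : V} (h : WalkIn G S a b) (hST : S ⊆ T) :
    WalkIn G T a b := by
  obtain ⟨w, hw⟩ := h
  exact ⟨w, fun v hv => hST (hw v hv)⟩

theorem WalkIn.of_adj {S : Set V} {a b : V} (h : G.Adj a b) (ha : a ∈ S) (hb : b ∈ S) :
    WalkIn G S a b :=
  ⟨h.toWalk, by simp [ha, hb]⟩

theorem WalkIn.left_mem {S : Set V} {a b : V} (h : WalkIn G S a b) : a ∈ S := by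
  obtain ⟨w, hw⟩ := h
  exact hw _ w.start_mem_support

theorem WalkIn.of_isChain {b : V} {l : List V} {a : V} (h : (a :: (l ++ [b])).IsChain G.Adj) :
    WalkIn G {v | v = a ∨ v = b ∨ v ∈ l} a b := by
  induction l generalizing a with
  | nil => exact .of_adj (by simpa using h) (by simp) (by simp)
  | cons c l ih =>
    rw [List.cons_append, List.isChain_cons_cons] at h
    exact (WalkIn.of_adj h.1 (by simp) (by simp)).trans ((ih h.2).mono fun v hv => by
      simp only [Set.mem_ofPred_eq, List.mem_cons] at hv ⊢; tauto)

/-- A walk in `T` can be shortened to a list without repetitions. -/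
theorem WalkIn.exists_list {T : Set V} {a b : V} (h : WalkIn G T a b) :
    ∃ P : List V, P.Nodup ∧ (∀ v ∈ P, v ∈ T) ∧ P ≠ [] ∧ P.IsChain G.Adj ∧ P.head? = some a ∧
      P.getLast? = some b := by
  classical
  obtain ⟨w, hw⟩ := h
  refine ⟨w.bypass.support, w.bypass_isPath.support_nodup,
    fun v hv => hw v (w.support_bypass_subset_support hv), by simp, w.bypass.isChain_adj_support, ?_, ?_⟩
  · rw [List.head?_eq_some_head (by simp), SimpleGraph.Walk.head_support]
  · rw [List.getLast?_eq_some_getLast (by simp), SimpleGraph.Walk.getLast_support]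

theorem exists_append_of_cons_sublist {a : V} {l L : List V} (h : (a :: l).Sublist L) :
    ∃ p q, L = p ++ a :: q ∧ l.Sublist q := by
  obtain ⟨r, s, rfl, ha, hl⟩ := List.cons_sublist_iff.1 h
  obtain ⟨p, q, rfl⟩ := List.append_of_mem ha
  exact ⟨p, q ++ s, by simp, hl.trans (List.sublist_append_right _ _)⟩

/-- Interleaving is a cyclic notion: moving the last of four elements to the front only exchanges
the roles of the two chords. -/
theorem IsNoncrossingList.rotate {p q : List V} (h : IsNoncrossingList G (p ++ q)) :
    IsNoncrossingList G (q ++ p) := by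
  induction p generalizing q with
  | nil => simpa using h
  | cons a p ih =>
    have : IsNoncrossingList G (p ++ (q ++ [a])) := by
      intro u w v x hs huv hwx
      rw [← List.append_assoc, List.sublist_append_iff] at hs
      obtain ⟨l₁, l₂, he, h1, h2⟩ := hs
      rcases List.sublist_singleton.1 h2 with rfl | rfl
      · rw [List.append_nil] at he
        exact h u w v x (he ▸ h1.trans (List.sublist_cons_self _ _)) huv hwx
      · have he' : [u, w, v] ++ [x] = l₁ ++ [a] := by simpa using he
        obtain ⟨h3, h4⟩ := List.append_inj' he' rfl
        obtain rfl : x = a := by simpa using h4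
        subst h3
        exact h x u w v (h1.cons_cons x) hwx.symm huv
    simpa using ih this

theorem IsCycleList.rotate {a b : V} {p q : List V} (h : IsCycleList G a (p ++ b :: q)) :
    IsCycleList G b (q ++ a :: p) := by
  obtain ⟨hn, hc⟩ := h
  refine ⟨?_, ?_⟩
  · have : (b :: (q ++ a :: p)).Perm (a :: (p ++ b :: q)) := by
      rw [← List.cons_append, ← List.cons_append]; exact List.perm_append_comm
    exact this.nodup_iff.2 hn
  · have h1 : (a :: p ++ b :: (q ++ [a])).IsChain G.Adj := by simpa using hc
    have h2 := List.isChain_split.1 h1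
    have h3 : (b :: q ++ a :: (p ++ [b])).IsChain G.Adj :=
      List.isChain_split.2 ⟨by simpa using h2.2, by simpa using h2.1⟩
    simpa using h3

theorem IsCycleList.exists_rotate {a c : V} {l : List V} (h : IsCycleList G a l)
    (hc : c ∈ a :: l) : ∃ m, IsCycleList G c m ∧ (c :: m).Perm (a :: l) := by
  rcases List.mem_cons.1 hc with rfl | hc
  · exact ⟨l, h, List.Perm.refl _⟩
  · obtain ⟨p, q, rfl⟩ := List.append_of_mem hc
    refine ⟨_, h.rotate, ?_⟩
    rw [← List.cons_append, ← List.cons_append]; exact List.perm_append_comm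

end Lists

/-! ### From outerplanar drawings to noncrossing orders -/

section Combinatorics

variable {V : Type*} {G : SimpleGraph V} [Finite V] (D : PlaneDrawing G)

/-- Four vertices cut the cycle into the four arcs needed by `no_crossing_chords`. -/
theorem IsCycleList.isNoncrossingList (hD : ∀ v, D.point v ∈ frontier D.outerFace) {a : V}
    {l : List V} (h : IsCycleList G a l) : IsNoncrossingList G (a :: l) := by
  intro u w v x hs huv hwx
  obtain ⟨p, q, hpq, hs⟩ := exists_append_of_cons_sublist hs
  obtain ⟨A, q₁, rfl, hs₁⟩ := exists_append_of_cons_sublist hs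
  obtain ⟨B, q₂, rfl, hs₂⟩ := exists_append_of_cons_sublist hs₁
  obtain ⟨C, E, rfl, -⟩ := exists_append_of_cons_sublist hs₂
  -- Rotating the cycle to start at `u` moves the part before `u` into the arc from `x` back to `u`.
  have hcyc : IsCycleList G u (A ++ w :: (B ++ v :: (C ++ x :: (E ++ p)))) := by
    cases p with
    | nil =>
      simp only [List.nil_append, List.cons.injEq] at hpq
      obtain ⟨rfl, rfl⟩ := hpq
      simpa using h
    | cons b p =>
      simp only [List.cons_append, List.cons.injEq] at hpq
      obtain ⟨rfl, rfl⟩ := hpq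
      simpa using h.rotate
  generalize E ++ p = E at hcyc
  obtain ⟨hn, hc⟩ := hcyc
  have hc1 : (u :: A ++ w :: (B ++ v :: (C ++ x :: (E ++ [u])))).IsChain G.Adj := by
    simpa using hc
  obtain ⟨hA, hc2⟩ := List.isChain_split.1 hc1
  obtain ⟨hB, hc3⟩ := List.isChain_split (l₁ := w :: B) (c := v).1 hc2
  obtain ⟨hC, hE⟩ := List.isChain_split (l₁ := v :: C) (c := x).1 hc3
  simp only [List.nodup_cons, List.nodup_append, List.mem_append, List.mem_cons, not_or,
    ne_eq, forall_eq_or_imp] at hn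
  refine D.no_crossing_chords hD huv hwx (WalkIn.of_isChain hA) (WalkIn.of_isChain hB)
    (WalkIn.of_isChain hC) (WalkIn.of_isChain hE) ?_ ?_ ?_ ?_ ?_ ?_ ?_ ?_ ?_ ?_
  · refine Set.disjoint_left.2 fun y hy hy' => ?_
    simp only [Set.mem_ofPred_eq] at hy hy'
    grind
  · refine Set.disjoint_left.2 fun y hy hy' => ?_
    simp only [Set.mem_ofPred_eq] at hy hy'
    grind
  all_goals simp only [Set.mem_ofPred_eq]; grind

/-- No vertex of `S` separates `S`. -/
def IsNonseparable (G : SimpleGraph V) (S : Set V) : Prop :=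
  ∀ c ∈ S, ∀ A : Set V, (∃ a ∈ S, a ≠ c ∧ a ∈ A) → (∃ b ∈ S, b ≠ c ∧ b ∉ A) →
    ∃ a ∈ S, ∃ b ∈ S, a ≠ c ∧ b ≠ c ∧ a ∈ A ∧ b ∉ A ∧ G.Adj a b

omit [Finite V] in
theorem pairwise_disjoint_vecCons {X Y Z : Set V} (h₁ : Disjoint X Y) (h₂ : Disjoint X Z)
    (h₃ : Disjoint Y Z) (j k : Fin 3) (hjk : j ≠ k) :
    Disjoint (![X, Y, Z] j) (![X, Y, Z] k) := by
  have : (j, k) ∈ [((0 : Fin 3), (1 : Fin 3)), (0, 2), (1, 0), (1, 2), (2, 0), (2, 1)] := by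
    revert j k; decide
  simp only [List.mem_cons, Prod.mk.injEq, List.not_mem_nil, or_false] at this
  rcases this with ⟨rfl, rfl⟩ | ⟨rfl, rfl⟩ | ⟨rfl, rfl⟩ | ⟨rfl, rfl⟩ | ⟨rfl, rfl⟩ | ⟨rfl, rfl⟩
  exacts [h₁, h₂, h₁.symm, h₃, h₂.symm, h₃.symm]

/-- By nonseparability, `x` reaches two distinct cycle vertices through vertices off the cycle. If
these are consecutive, the detour replaces the edge between them. Otherwise the two arcs of the
cycle and the off-cycle set form a subdivided `K₂,₃`. -/
theorem IsCycleList.exists_longer (hD : ∀ v, D.point v ∈ frontier D.outerFace) {S : Set V}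
    (hS : IsNonseparable G S) {a : V} {l : List V} (h : IsCycleList G a l)
    (hl : ∀ v ∈ a :: l, v ∈ S) {x : V} (hxS : x ∈ S) (hx : x ∉ a :: l) :
    ∃ b m, IsCycleList G b m ∧ (∀ v ∈ b :: m, v ∈ S) ∧ l.length < m.length := by
  have hne : l ≠ [] := by
    rintro rfl
    have := h.2
    simp at this
  obtain ⟨b, hb⟩ := List.exists_mem_of_ne_nil l hne
  have hba : b ≠ a := by
    rintro rfl
    exact (List.nodup_cons.1 h.1).1 hb
  set T : Set V := {v | v ∈ S ∧ v ∉ a :: l} with hT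
  have hxx : WalkIn G T x x := ⟨.nil, fun v hv => by
    obtain rfl : v = x := by simpa using hv
    exact ⟨hxS, hx⟩⟩
  have hTright : ∀ {y z}, WalkIn G T y z → z ∈ T := fun h => h.symm.left_mem
  -- With `c` deleted, some edge leaves the set reachable from `x` inside `T`; its far end cannot
  -- lie in `T`, hence is on the cycle.
  have attach : ∀ c ∈ a :: l, ∀ b ∈ a :: l, b ≠ c → ∃ y d, WalkIn G T x y ∧ G.Adj d y ∧
      d ∈ a :: l ∧ d ≠ c := by
    intro c hc b hb hbc
    obtain ⟨y, -, d, hdS, -, hdc, hy, hd, hyd⟩ := hS c (hl c hc) {y | WalkIn G T x y}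
      ⟨x, hxS, fun h => hx (h ▸ hc), hxx⟩ ⟨b, hl b hb, hbc, fun h => (hTright h).2 hb⟩
    refine ⟨y, d, hy, hyd.symm, ?_, hdc⟩
    by_contra hdl
    exact hd (hy.trans (.of_adj hyd (hTright hy) ⟨hdS, hdl⟩))
  obtain ⟨y₀, c₀, hy₀, hadj₀, hc₀, -⟩ := attach a (by simp) b (by simp [hb]) hba
  obtain ⟨y₁, c₁, hy₁, hadj₁, hc₁, hc₁₀⟩ : ∃ y d, WalkIn G T x y ∧ G.Adj d y ∧
      d ∈ a :: l ∧ d ≠ c₀ := by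
    by_cases hac : a = c₀
    · exact attach c₀ hc₀ b (by simp [hb]) (hac ▸ hba)
    · exact attach c₀ hc₀ a (by simp) hac
  obtain ⟨m, hm, hperm⟩ := h.exists_rotate hc₀
  have hc₁m : c₁ ∈ m := (List.mem_cons.1 (hperm.mem_iff.2 hc₁)).resolve_left hc₁₀
  have hlen : m.length = l.length := by simpa using hperm.length_eq
  have hmS : ∀ v ∈ c₀ :: m, v ∈ S := fun v hv => hl v (hperm.mem_iff.1 hv)
  have hmT : ∀ v ∈ c₀ :: m, v ∉ T := fun v hv hvT => hvT.2 (hperm.mem_iff.1 hv)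
  have hyy : WalkIn G T y₀ y₁ := hy₀.symm.trans hy₁
  obtain ⟨P, hPn, hPT, hPne, hPc, hPh, hPl⟩ := hyy.exists_list
  have hPpos : 0 < P.length := List.length_pos_iff.2 hPne
  obtain ⟨A, B, rfl⟩ := List.append_of_mem hc₁m
  obtain ⟨hmn, hmc⟩ := hm
  rcases A with _ | ⟨a₁, A⟩
  -- Here `c₁` directly follows `c₀`; this includes the degenerate cycle with a single edge.
  · refine ⟨c₀, P ++ c₁ :: B, ⟨?_, ?_⟩, ?_, ?_⟩
    · simp only [List.nil_append, List.nodup_cons, List.mem_cons, not_or, List.nodup_append,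
        List.mem_append] at hmn hmT ⊢
      grind
    · have h1 : (c₁ :: (B ++ [c₀])).IsChain G.Adj := by
        simp only [List.nil_append, List.cons_append] at hmc
        exact hmc.tail
      rw [List.append_assoc, List.isChain_cons, List.isChain_append]
      refine ⟨?_, hPc, h1, ?_⟩
      · intro y hy
        rw [List.head?_append_of_ne_nil _ hPne, hPh] at hy
        obtain rfl : y₀ = y := by simpa using hy
        exact hadj₀
      · intro y hy z hz
        rw [hPl] at hy
        obtain rfl : y₁ = y := by simpa using hy
        obtain rfl : c₁ = z := by simpa using hz
        exact hadj₁.symm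
    · intro v hv
      simp only [List.mem_cons, List.mem_append] at hv
      rcases hv with rfl | hv | rfl | hv
      exacts [hmS _ (by simp), (hPT v hv).1, hmS _ (by simp), hmS _ (by simp [hv])]
    · simp only [← hlen, List.length_append, List.length_cons, List.nil_append]; omega
  rcases B with _ | ⟨b₁, B⟩
  -- Here `c₁` directly precedes `c₀`, so the detour is run backwards.
  · refine ⟨c₁, P.reverse ++ c₀ :: a₁ :: A, ⟨?_, ?_⟩, ?_, ?_⟩
    · simp only [List.nodup_cons, List.mem_cons, not_or, List.nodup_append,
        List.mem_append, List.nodup_reverse, List.mem_reverse, List.cons_append] at hmn hmT ⊢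
      grind
    · have h1 : (c₀ :: a₁ :: (A ++ [c₁])).IsChain G.Adj := by
        have : ((c₀ :: a₁ :: (A ++ [c₁])) ++ [c₀]).IsChain G.Adj := by simpa using hmc
        exact this.left_of_append
      rw [List.append_assoc, List.isChain_cons, List.isChain_append]
      refine ⟨?_, ?_, h1, ?_⟩
      · intro y hy
        rw [List.head?_append_of_ne_nil _ (by simpa using hPne), List.head?_reverse, hPl] at hy
        obtain rfl : y₁ = y := by simpa using hy
        exact hadj₁
      · rw [List.isChain_reverse]
        exact hPc.imp fun _ _ h => h.symm
      · intro y hy z hz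
        rw [List.getLast?_reverse, hPh] at hy
        obtain rfl : y₀ = y := by simpa using hy
        obtain rfl : c₀ = z := by simpa using hz
        exact hadj₀.symm
    · intro v hv
      simp only [List.mem_cons, List.mem_append, List.mem_reverse] at hv
      rcases hv with rfl | hv | rfl | rfl | hv
      exacts [hmS _ (by simp), (hPT v hv).1, hmS _ (by simp), hmS _ (by simp), hmS _ (by simp [hv])]
    · simp only [← hlen, List.length_append, List.length_cons, List.length_reverse,
        List.length_nil]; omega
  exfalso
  have hc1 : (c₀ :: a₁ :: A ++ c₁ :: (b₁ :: B ++ [c₀])).IsChain G.Adj := by simpa using hmc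
  obtain ⟨hA, hB⟩ := List.isChain_split.1 hc1
  simp only [List.cons_append, List.isChain_cons_cons] at hA hB
  simp only [List.nodup_cons, List.mem_cons, not_or, List.nodup_append,
        List.mem_append, List.cons_append] at hmn hmT
  refine D.no_theta hD hc₁₀.symm ![{v | v ∈ a₁ :: A}, {v | v ∈ b₁ :: B}, T] ![a₁, b₁, y₀]
    ?_ ?_ ?_ ?_ ?_ ?_
  · intro j
    fin_cases j
    · simp
    · simp
    · exact hyy.left_mem
  · refine pairwise_disjoint_vecCons ?_ ?_ ?_ <;>
    · refine Set.disjoint_left.2 fun y hy hy' => ?_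
      simp only [Set.mem_ofPred_eq, List.mem_cons] at hy hy'
      grind
  · intro j
    fin_cases j
    · simp; grind
    · simp; grind
    · exact hmT c₀ (by simp)
  · intro j
    fin_cases j
    · simp; grind
    · simp; grind
    · exact hmT c₁ (by simp)
  · intro j
    fin_cases j
    · exact .of_adj hA.1 (by simp) (by simp)
    · exact (WalkIn.of_isChain hB.2).symm.mono fun v hv => by simpa [or_left_comm] using hv
    · exact .of_adj hadj₀ (by simp) (by simp [hyy.left_mem])
  · intro j
    fin_cases j
    · exact (WalkIn.of_isChain hA.2).symm.mono fun v hv => by simpa [or_left_comm] using hv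
    · exact .of_adj hB.1 (by simp) (by simp)
    · exact (WalkIn.of_adj (S := insert c₁ T) hadj₁ (by simp) (by simp [hTright hyy])).trans
        (hyy.symm.mono (Set.subset_insert _ _))

/-- A nonseparable vertex set of an outerplanar graph has a Hamiltonian cycle. -/
theorem exists_hamiltonian_isCycleList (hD : ∀ v, D.point v ∈ frontier D.outerFace)
    {S : Finset V} (hS : IsNonseparable G (S : Set V)) (h3 : 3 ≤ S.card) :
    ∃ a l, IsCycleList G a l ∧ ∀ v, v ∈ a :: l ↔ v ∈ S := by
  by_contra! hcon
  -- If no cycle exhausts `S`, cycles can be lengthened indefinitely, starting from a single edge,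
  -- which exceeds the size of `S`.
  have long : ∀ k : ℕ, ∃ a l, IsCycleList G a l ∧ (∀ v ∈ a :: l, v ∈ S) ∧ k ≤ l.length := by
    intro k
    induction k with
    | zero =>
      obtain ⟨a, b, c, ha, hb, hc, hab, hac, hbc⟩ := Finset.two_lt_card_iff.1 h3
      obtain ⟨y, -, d, hd, -, -, hy, hda, hyd⟩ := hS c hc {a} ⟨a, ha, hac, rfl⟩
        ⟨b, hb, hbc, by simpa using hab.symm⟩
      obtain rfl : y = a := hy
      refine ⟨y, [d], ⟨by simpa using hyd.ne, by simp [hyd, hyd.symm]⟩, ?_, by simp⟩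
      simpa using ⟨ha, hd⟩
    | succ k ih =>
      obtain ⟨a, l, hc, hl, hk⟩ := ih
      obtain ⟨x, hx⟩ := hcon a l hc
      have hx : x ∈ S ∧ x ∉ a :: l := by
        rcases hx with hx | hx
        · exact (hx.2 (hl x hx.1)).elim
        · exact ⟨hx.2, hx.1⟩
      obtain ⟨b, m, hm, hmS, hlt⟩ := hc.exists_longer D hD hS hl hx.1 hx.2
      exact ⟨b, m, hm, hmS, by omega⟩
  classical
  obtain ⟨a, l, hc, hl, hk⟩ := long S.card
  have h1 : (a :: l).toFinset ⊆ S := fun v hv => hl v (List.mem_toFinset.1 hv)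
  have h2 := Finset.card_le_card h1
  rw [List.toFinset_card_of_nodup hc.1, List.length_cons] at h2
  omega

omit [Finite V] in
-- Four interleaved vertices either all lie in one of the two lists, `c` included, or one of their
-- chords joins `l₁` to `l₂`.
theorem IsNoncrossingList.glue {c : V} {l₁ l₂ : List V}
    (h₁ : IsNoncrossingList G (c :: l₁)) (h₂ : IsNoncrossingList G (c :: l₂))
    (hadj : ∀ a ∈ l₁, ∀ b ∈ l₂, ¬ G.Adj a b) :
    IsNoncrossingList G (c :: (l₁ ++ l₂)) := by
  intro u w v x hs huv hwx
  rw [← List.cons_append, List.sublist_append_iff] at hs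
  obtain ⟨p, q, he, hp, hq⟩ := hs
  rcases p with _ | ⟨p₁, _ | ⟨p₂, p⟩⟩
  · simp only [List.nil_append] at he
    exact h₂ u w v x (he ▸ hq.trans (List.sublist_cons_self _ _)) huv hwx
  · simp only [List.cons_append, List.nil_append, List.cons.injEq] at he
    obtain ⟨rfl, rfl⟩ := he
    rcases List.mem_cons.1 (hp.subset (List.mem_singleton_self _)) with rfl | hu
    · exact h₂ _ w v x (hq.cons_cons _) huv hwx
    · exact hadj u hu v (hq.subset (by simp)) huv
  · simp only [List.cons_append, List.cons.injEq] at he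
    obtain ⟨rfl, rfl, he⟩ := he
    have hw : w ∈ l₁ := hp.tail.subset (by simp)
    rcases List.eq_nil_or_concat q with rfl | ⟨q, y, rfl⟩
    · rw [List.append_nil] at he
      subst he
      exact h₁ u w v x hp huv hwx
    · have he' : [v] ++ [x] = (p ++ q) ++ [y] := by simpa using he
      obtain ⟨-, h4⟩ := List.append_inj' he' rfl
      obtain rfl : x = y := by simpa using h4
      exact hadj w hw x (hq.subset (by simp)) hwx

omit [Finite V] in
theorem IsNoncrossingList.exists_cons {c : V} {L : List V} (hn : L.Nodup)
    (h : IsNoncrossingList G L) (hc : c ∈ L) :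
    ∃ l, (c :: l).Nodup ∧ IsNoncrossingList G (c :: l) ∧ ∀ v, v ∈ c :: l ↔ v ∈ L := by
  obtain ⟨p, q, rfl⟩ := List.append_of_mem hc
  exact ⟨q ++ p, (List.perm_append_comm (l₁ := c :: q) (l₂ := p)).nodup_iff.2 hn, h.rotate,
    fun v => (List.perm_append_comm (l₁ := c :: q) (l₂ := p)).mem_iff⟩

/-- Strong induction along the block structure. A nonseparable set is ordered by a Hamiltonian
cycle. Otherwise a cut vertex `c` belongs to both smaller sides, both orders are rotated to begin
with `c`, and they are concatenated. -/
theorem exists_isNoncrossingList (hD : ∀ v, D.point v ∈ frontier D.outerFace) (S : Finset V) :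
    ∃ L : List V, L.Nodup ∧ (∀ v, v ∈ L ↔ v ∈ S) ∧ IsNoncrossingList G L := by
  classical
  induction S using Finset.strongInduction with
  | H S ih =>
  by_cases h3 : S.card ≤ 3
  · refine ⟨S.toList, S.nodup_toList, by simp, fun u w v x hs => ?_⟩
    have := hs.length_le
    simp at this
    omega
  by_cases hS : IsNonseparable G (S : Set V)
  · obtain ⟨a, l, hc, hl⟩ := exists_hamiltonian_isCycleList D hD hS (by omega)
    exact ⟨a :: l, hc.1, hl, hc.isNoncrossingList D hD⟩
  unfold IsNonseparable at hS
  push Not at hS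
  obtain ⟨c, hc, A, ⟨a, ha, hac, haA⟩, ⟨b, hb, hbc, hbA⟩, hadj⟩ := hS
  simp only [Finset.mem_coe] at hc ha hb hadj
  obtain ⟨L₁, hn₁, hm₁, hL₁⟩ := ih (S.filter fun v => v = c ∨ v ∈ A)
    (Finset.filter_ssubset.2 ⟨b, hb, by simp [hbc, hbA]⟩)
  obtain ⟨L₂, hn₂, hm₂, hL₂⟩ := ih (S.filter fun v => v = c ∨ v ∉ A)
    (Finset.filter_ssubset.2 ⟨a, ha, by simp [hac, haA]⟩)
  obtain ⟨l₁, hn₁, hL₁, he₁⟩ := hL₁.exists_cons hn₁ ((hm₁ c).2 (by simp [hc]))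
  obtain ⟨l₂, hn₂, hL₂, he₂⟩ := hL₂.exists_cons hn₂ ((hm₂ c).2 (by simp [hc]))
  simp only [hm₁, hm₂, Finset.mem_filter, List.mem_cons] at he₁ he₂
  rw [List.nodup_cons] at hn₁ hn₂
  have hl₁ : ∀ v ∈ l₁, v ∈ S ∧ v ≠ c ∧ v ∈ A := fun v hv => by
    have hvc : v ≠ c := fun h => hn₁.1 (h ▸ hv)
    have := (he₁ v).1 (Or.inr hv)
    tauto
  have hl₂ : ∀ v ∈ l₂, v ∈ S ∧ v ≠ c ∧ v ∉ A := fun v hv => by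
    have hvc : v ≠ c := fun h => hn₂.1 (h ▸ hv)
    have := (he₂ v).1 (Or.inr hv)
    tauto
  refine ⟨c :: (l₁ ++ l₂), ?_, fun v => ?_, hL₁.glue hL₂ fun x hx y hy => ?_⟩
  · rw [List.nodup_cons, List.nodup_append, List.mem_append]
    refine ⟨by tauto, hn₁.2, hn₂.2, ?_⟩
    rintro x hx _ hy rfl
    exact (hl₂ x hy).2.2 (hl₁ x hx).2.2
  · have := he₁ v
    have := he₂ v
    by_cases hvA : v ∈ A <;> by_cases hvc : v = c <;> simp_all
  · exact hadj x (hl₁ x hx).1 y (hl₂ y hy).1 (hl₁ x hx).2.1 (hl₂ y hy).2.1 (hl₁ x hx).2.2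
      (hl₂ y hy).2.2

theorem IsOuterplanar.exists_isNoncrossingOrder (h : IsOuterplanar G) :
    ∃ f : V → ℕ, IsNoncrossingOrder G f := by
  classical
  obtain ⟨D, hD⟩ := h
  have := Fintype.ofFinite V
  obtain ⟨L, -, hL, hN⟩ := exists_isNoncrossingList D hD Finset.univ
  simp only [Finset.mem_univ, iff_true] at hL
  have hget : ∀ v, L[L.idxOf v]'(List.idxOf_lt_length_of_mem (hL v)) = v := fun v =>
    List.getElem_idxOf _
  refine ⟨fun v => L.idxOf v, fun v w h => (List.idxOf_inj (hL v)).1 h, ?_⟩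
  intro u w v x huw hwv hvx
  refine hN u w v x ?_
  let i : V → Fin L.length := fun v => ⟨L.idxOf v, List.idxOf_lt_length_of_mem (hL v)⟩
  have hs := List.map_getElem_sublist (l := L) (is := [i u, i w, i v, i x]) (by
    simp only [List.pairwise_cons, List.mem_cons, List.not_mem_nil, or_false, forall_eq_or_imp,
      forall_eq, Fin.lt_def, i]
    simp
    omega)
  simpa [i, hget] using hs

end Combinatorics

/-! ### Stick representations and noncrossing orders -/

theorem mem_stick_true {m b x r : ℝ} (hr : 0 < r) {p : ℝ × ℝ} :
    p ∈ stick m b true x r ↔ x ≤ p.1 ∧ p.1 ≤ x + r ∧ p.2 = m * x + b := by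
  obtain ⟨p₁, p₂⟩ := p
  simp only [stick, if_true, segment_eq_image', Set.mem_image, Set.mem_Icc, Prod.mk_sub_mk,
    Prod.smul_mk, Prod.mk_add_mk, Prod.mk.injEq, smul_eq_mul]
  constructor
  · rintro ⟨t, ⟨h0, h1⟩, rfl, rfl⟩
    exact ⟨by nlinarith, by nlinarith, by ring⟩
  · rintro ⟨h1, h2, rfl⟩
    refine ⟨(p₁ - x) / r, ⟨by apply div_nonneg <;> linarith, by rw [div_le_one hr]; linarith⟩, ?_,
      by ring⟩
    field_simp
    ring

theorem mem_stick_false {m b x r : ℝ} (hr : 0 < r) {p : ℝ × ℝ} :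
    p ∈ stick m b false x r ↔ p.1 = x ∧ m * x + b - r ≤ p.2 ∧ p.2 ≤ m * x + b := by
  obtain ⟨p₁, p₂⟩ := p
  simp only [stick, Bool.false_eq_true, if_false, segment_eq_image', Set.mem_image, Set.mem_Icc,
    Prod.mk_sub_mk, Prod.smul_mk, Prod.mk_add_mk, Prod.mk.injEq, smul_eq_mul]
  constructor
  · rintro ⟨t, ⟨h0, h1⟩, rfl, rfl⟩
    exact ⟨by ring, by nlinarith, by nlinarith⟩
  · rintro ⟨rfl, h1, h2⟩
    refine ⟨(m * p₁ + b - p₂) / r, ⟨by apply div_nonneg <;> linarith,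
      by rw [div_le_one hr]; linarith⟩, by ring, ?_⟩
    field_simp
    ring

theorem foot_mem_stick (m b : ℝ) (h : Bool) (x r : ℝ) : (x, m * x + b) ∈ stick m b h x r := by
  cases h
  · simpa [stick] using left_mem_segment ℝ _ _
  · simpa [stick] using left_mem_segment ℝ _ _

/-- The only possible common point is `(x', m * x + b)`. All later stick geometry reduces to these
inequalities. -/
theorem stick_inter_stick_nonempty {m b x x' r r' : ℝ} (hr : 0 < r) (hr' : 0 < r') (hm : 0 < m) :
    (stick m b true x r ∩ stick m b false x' r').Nonempty ↔
      x ≤ x' ∧ x' - x ≤ r ∧ m * (x' - x) ≤ r' := by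
  constructor
  · rintro ⟨p, hp, hp'⟩
    rw [mem_stick_true hr] at hp
    rw [mem_stick_false hr'] at hp'
    obtain ⟨h1, h2, h3⟩ := hp
    obtain ⟨h4, h5, h6⟩ := hp'
    rw [h4] at h1 h2
    rw [h3] at h5
    exact ⟨h1, by linarith, by linarith⟩
  · rintro ⟨h1, h2, h3⟩
    refine ⟨(x', m * x + b), (mem_stick_true hr).2 ⟨h1, by simp only; linarith, rfl⟩,
      (mem_stick_false hr').2 ⟨rfl, by simp only; linarith, ?_⟩⟩
    have := mul_le_mul_of_nonneg_left h1 hm.le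
    simp only
    linarith

theorem stick_disjoint_stick {m b x x' r r' : ℝ} (hr : 0 < r) (hr' : 0 < r') (hm : 0 < m)
    (h : Bool) (hx : x ≠ x') : Disjoint (stick m b h x r) (stick m b h x' r') := by
  refine Set.disjoint_left.2 fun p hp hp' => hx ?_
  cases h
  · rw [mem_stick_false hr] at hp
    rw [mem_stick_false hr'] at hp'
    exact hp.1.symm.trans hp'.1
  · rw [mem_stick_true hr] at hp
    rw [mem_stick_true hr'] at hp'
    have := hp.2.2.symm.trans hp'.2.2
    exact mul_left_cancel₀ hm.ne' (by linarith)

section Incidence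

open IncidencePoset

variable {V : Type*} {G : SimpleGraph V}

theorem comparabilityGraph_adj_vertex_edge {v : V} {e : G.edgeSet} :
    (comparabilityGraph (IncidencePoset G)).Adj (vertex v) (edge e) ↔ v ∈ (e : Sym2 V) := by
  constructor
  · rintro ⟨-, h | h⟩
    · cases h with
      | incident _ _ h => exact h
    · cases h
  · exact fun h => ⟨nofun, Or.inl (Le.incident v e h)⟩

theorem not_comparabilityGraph_adj_vertex_vertex {v w : V} :
    ¬ (comparabilityGraph (IncidencePoset G)).Adj (vertex v) (vertex w) := by
  rintro ⟨h, h' | h'⟩ <;> cases h' <;> exact h rfl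

theorem not_comparabilityGraph_adj_edge_edge {e f : G.edgeSet} :
    ¬ (comparabilityGraph (IncidencePoset G)).Adj (edge e) (edge f) := by
  rintro ⟨h, h' | h'⟩ <;> cases h' <;> exact h rfl

/-! ### From stick representations to noncrossing orders -/

namespace StickRepresentation

variable {W : Type*} {H : SimpleGraph W} (R : StickRepresentation H)

theorem horizontal_ne_of_adj {v w : W} (h : H.Adj v w) : R.horizontal v ≠ R.horizontal w :=
  fun he => Set.not_disjoint_iff_nonempty_inter.2 ((R.adj_iff v w).1 h).2
    (R.parallel_disjoint v w h.ne he)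

theorem eq_of_foot_eq {v w : W} (hh : R.horizontal v = R.horizontal w)
    (hf : R.foot v = R.foot w) : v = w := by
  by_contra hne
  refine Set.disjoint_left.1 (R.parallel_disjoint v w hne hh)
    (foot_mem_stick R.slope R.intercept _ (R.foot v) _) ?_
  rw [hf]
  exact foot_mem_stick R.slope R.intercept _ (R.foot w) _

theorem adj_iff_of_horizontal {v w : W} (hv : R.horizontal v = true)
    (hw : R.horizontal w = false) : H.Adj v w ↔ R.foot v ≤ R.foot w ∧
      R.foot w - R.foot v ≤ R.length v ∧ R.slope * (R.foot w - R.foot v) ≤ R.length w := by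
  rw [R.adj_iff, hv, hw, stick_inter_stick_nonempty (R.length_pos v) (R.length_pos w) R.slope_pos,
    and_iff_right]
  rintro rfl
  simp_all

/-- The vertical stick of `uv` drops past the height of `w`, yet misses `w`, so `w` ends before
reaching it. As `w` does reach the stick of `wx`, that stick lies left of the stick of `uv`. The
same reasoning at `v` gives the reverse strict inequality. -/
theorem not_crossing_of_horizontal (R : StickRepresentation (comparabilityGraph (IncidencePoset G)))
    {u w v x : V} (hw : R.horizontal (vertex w) = true)
    (hv : R.horizontal (vertex v) = true) (huw : R.foot (vertex u) < R.foot (vertex w))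
    (hwv : R.foot (vertex w) < R.foot (vertex v)) (hvx : R.foot (vertex v) < R.foot (vertex x))
    (huv : G.Adj u v) (hwx : G.Adj w x) : False := by
  have inc : ∀ {a b : V} (h : G.Adj a b), (comparabilityGraph (IncidencePoset G)).Adj (vertex a)
      (edge ⟨s(a, b), h⟩) ∧ (comparabilityGraph (IncidencePoset G)).Adj (vertex b)
      (edge ⟨s(a, b), h⟩) := fun h => by simp [comparabilityGraph_adj_vertex_edge]
  have ninc : ∀ {a b c : V} (h : G.Adj a b), c ≠ a → c ≠ b →
      ¬ (comparabilityGraph (IncidencePoset G)).Adj (vertex c) (edge ⟨s(a, b), h⟩) :=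
    fun h h1 h2 => by simp [comparabilityGraph_adj_vertex_edge, h1, h2]
  have hwu : w ≠ u := by rintro rfl; exact huw.false
  have hwv' : w ≠ v := by rintro rfl; exact hwv.false
  have hvx' : v ≠ x := by rintro rfl; exact hvx.false
  have he : R.horizontal (edge ⟨s(u, v), huv⟩) = false := by
    simpa [hv] using (R.horizontal_ne_of_adj (inc huv).2).symm
  have hf : R.horizontal (edge ⟨s(w, x), hwx⟩) = false := by
    simpa [hw] using (R.horizontal_ne_of_adj (inc hwx).1).symm
  have hu : R.horizontal (vertex u) = true := by
    simpa [he] using R.horizontal_ne_of_adj (inc huv).1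
  have hx : R.horizontal (vertex x) = true := by
    simpa [hf] using R.horizontal_ne_of_adj (inc hwx).2
  have h1 := (R.adj_iff_of_horizontal hu he).1 (inc huv).1
  have h2 := (R.adj_iff_of_horizontal hv he).1 (inc huv).2
  have h3 := (R.adj_iff_of_horizontal hw hf).1 (inc hwx).1
  have h4 := (R.adj_iff_of_horizontal hx hf).1 (inc hwx).2
  have h5 := mt (R.adj_iff_of_horizontal hw he).2 (ninc huv hwu hwv')
  have h6 := mt (R.adj_iff_of_horizontal hv hf).2 (ninc hwx hwv'.symm hvx')
  have hm := R.slope_pos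
  simp only [not_and_or, not_le] at h5 h6
  have m1 := mul_lt_mul_of_pos_left huw hm
  have m2 := mul_lt_mul_of_pos_left hwv hm
  simp only [mul_sub] at *
  rcases h5 with h5 | h5 | h5 <;> rcases h6 with h6 | h6 | h6 <;> linarith

/-- The horizontal sticks of `uv` and `wx` pass the abscissas of `w` and `v` respectively, so a miss
means that the vertical stick stops above. At `w` this puts `uv` strictly below `wx`, at `v`
strictly above. -/
theorem not_crossing_of_vertical (R : StickRepresentation (comparabilityGraph (IncidencePoset G)))
    {u w v x : V} (hw : R.horizontal (vertex w) = false)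
    (hv : R.horizontal (vertex v) = false) (huw : R.foot (vertex u) < R.foot (vertex w))
    (hwv : R.foot (vertex w) < R.foot (vertex v)) (hvx : R.foot (vertex v) < R.foot (vertex x))
    (huv : G.Adj u v) (hwx : G.Adj w x) : False := by
  have inc : ∀ {a b : V} (h : G.Adj a b), (comparabilityGraph (IncidencePoset G)).Adj
      (edge ⟨s(a, b), h⟩) (vertex a) ∧ (comparabilityGraph (IncidencePoset G)).Adj
      (edge ⟨s(a, b), h⟩) (vertex b) := fun h => by
    simp [SimpleGraph.adj_comm, comparabilityGraph_adj_vertex_edge]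
  have ninc : ∀ {a b c : V} (h : G.Adj a b), c ≠ a → c ≠ b →
      ¬ (comparabilityGraph (IncidencePoset G)).Adj (edge ⟨s(a, b), h⟩) (vertex c) :=
    fun h h1 h2 => by
      simp [SimpleGraph.adj_comm, comparabilityGraph_adj_vertex_edge, h1, h2]
  have hwu : w ≠ u := by rintro rfl; exact huw.false
  have hwv' : w ≠ v := by rintro rfl; exact hwv.false
  have hvx' : v ≠ x := by rintro rfl; exact hvx.false
  have he : R.horizontal (edge ⟨s(u, v), huv⟩) = true := by
    simpa [hv] using R.horizontal_ne_of_adj (inc huv).2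
  have hf : R.horizontal (edge ⟨s(w, x), hwx⟩) = true := by
    simpa [hw] using R.horizontal_ne_of_adj (inc hwx).1
  have hu : R.horizontal (vertex u) = false := by
    simpa [he] using (R.horizontal_ne_of_adj (inc huv).1).symm
  have hx : R.horizontal (vertex x) = false := by
    simpa [hf] using (R.horizontal_ne_of_adj (inc hwx).2).symm
  have h1 := (R.adj_iff_of_horizontal he hu).1 (inc huv).1
  have h2 := (R.adj_iff_of_horizontal he hv).1 (inc huv).2
  have h3 := (R.adj_iff_of_horizontal hf hw).1 (inc hwx).1
  have h4 := (R.adj_iff_of_horizontal hf hx).1 (inc hwx).2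
  have h5 := mt (R.adj_iff_of_horizontal he hw).2 (ninc huv hwu hwv')
  have h6 := mt (R.adj_iff_of_horizontal hf hv).2 (ninc hwx hwv'.symm hvx')
  have hm := R.slope_pos
  simp only [not_and_or, not_le] at h5 h6
  have m1 := mul_lt_mul_of_pos_left hwv hm
  have m2 := mul_lt_mul_of_pos_left hvx hm
  have m3 : R.slope * R.foot (edge ⟨s(u, v), huv⟩) ≤ R.slope * R.foot (edge ⟨s(w, x), hwx⟩) ∨
      R.slope * R.foot (edge ⟨s(w, x), hwx⟩) ≤ R.slope * R.foot (edge ⟨s(u, v), huv⟩) :=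
    le_total _ _
  simp only [mul_sub] at *
  rcases h5 with h5 | h5 | h5 <;> rcases h6 with h6 | h6 | h6 <;> rcases m3 with m3 | m3 <;>
    linarith

theorem exists_isNoncrossingOrder
    (R : StickRepresentation (comparabilityGraph (IncidencePoset G))) :
    ∃ f : V → ℝ, IsNoncrossingOrder G f := by
  -- The sign places all horizontal vertices before all vertical ones. Edges never join the two
  -- kinds, so interleaved edges are of one kind. The order of the horizontal feet is reversed,
  -- which preserves interleaving.
  set f : V → ℝ := fun v => if R.horizontal (vertex v) = true then -Real.exp (R.foot (vertex v))
    else Real.exp (R.foot (vertex v)) with hf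
  have htrue : ∀ v, R.horizontal (vertex v) = true → f v = -Real.exp (R.foot (vertex v)) :=
    fun v hv => if_pos hv
  have hfalse : ∀ v, R.horizontal (vertex v) = false → f v = Real.exp (R.foot (vertex v)) :=
    fun v hv => if_neg (by simp [hv])
  have hpos : ∀ v, R.horizontal (vertex v) = false ↔ 0 < f v := fun v => by
    cases h : R.horizontal (vertex v)
    · simp [hfalse v h, Real.exp_pos]
    · simp [htrue v h, (Real.exp_pos _).le]
  have hsame : ∀ a b, f a < f b → R.horizontal (vertex a) = R.horizontal (vertex b) →
      (R.horizontal (vertex a) = true ∧ R.foot (vertex b) < R.foot (vertex a)) ∨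
      (R.horizontal (vertex a) = false ∧ R.foot (vertex a) < R.foot (vertex b)) := by
    intro a b hab h
    cases ha : R.horizontal (vertex a)
    · rw [hfalse a ha, hfalse b (h ▸ ha), Real.exp_lt_exp] at hab
      exact Or.inr ⟨rfl, hab⟩
    · rw [htrue a ha, htrue b (h ▸ ha), neg_lt_neg_iff, Real.exp_lt_exp] at hab
      exact Or.inl ⟨rfl, hab⟩
  have hedge : ∀ {a b}, G.Adj a b → R.horizontal (vertex a) = R.horizontal (vertex b) := by
    intro a b h
    have h1 := R.horizontal_ne_of_adj ((comparabilityGraph_adj_vertex_edge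
      (e := ⟨s(a, b), h⟩)).2 (Sym2.mem_mk_left a b))
    have h2 := R.horizontal_ne_of_adj ((comparabilityGraph_adj_vertex_edge
      (e := ⟨s(a, b), h⟩)).2 (Sym2.mem_mk_right a b))
    revert h1 h2
    cases R.horizontal (vertex a) <;> cases R.horizontal (vertex b) <;> simp
  refine ⟨f, fun a b hab => ?_, fun u w v x huw hwv hvx huv hwx => ?_⟩
  · have hh : R.horizontal (vertex a) = R.horizontal (vertex b) := by
      have : R.horizontal (vertex a) = false ↔ R.horizontal (vertex b) = false := by
        rw [hpos, hpos, hab]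
      revert this
      cases R.horizontal (vertex a) <;> cases R.horizontal (vertex b) <;> simp
    have hfoot : R.foot (vertex a) = R.foot (vertex b) := by
      cases ha : R.horizontal (vertex a)
      · rwa [hfalse a ha, hfalse b (hh ▸ ha), Real.exp_eq_exp] at hab
      · rwa [htrue a ha, htrue b (hh ▸ ha), neg_inj, Real.exp_eq_exp] at hab
    exact vertex.inj (R.eq_of_foot_eq hh hfoot)
  · have e1 := hedge huv
    have e2 := hedge hwx
    have hwveq : R.horizontal (vertex w) = R.horizontal (vertex v) := by
      have hu := hpos u
      have hw := hpos w
      have hv := hpos v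
      cases hvb : R.horizontal (vertex v)
      · rw [e1, hvb] at hu
        exact hw.2 ((hu.1 rfl).trans huw)
      · rw [hvb] at hv
        cases hwb : R.horizontal (vertex w)
        · exact absurd (hv.2 ((hw.1 hwb).trans hwv)) (by simp)
        · rfl
    have s1 := hsame u w huw (e1.trans hwveq.symm)
    have s2 := hsame w v hwv hwveq
    have s3 := hsame v x hvx (hwveq.symm.trans e2)
    cases hvb : R.horizontal (vertex v)
    · have hwb := hwveq.trans hvb
      have hub := e1.trans hvb
      simp only [hub, hwb, hvb, Bool.false_eq_true, false_and, false_or, true_and] at s1 s2 s3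
      exact R.not_crossing_of_vertical hwb hvb s1 s2 s3 huv hwx
    · have hwb := hwveq.trans hvb
      have hub := e1.trans hvb
      simp only [hub, hwb, hvb, Bool.true_eq_false, false_and, or_false, true_and] at s1 s2 s3
      exact R.not_crossing_of_horizontal hvb hwb s3 s2 s1 hwx.symm huv.symm

end StickRepresentation

/-! ### From noncrossing orders to stick representations -/

theorem exists_ordered_endpoints {α : Type*} [LinearOrder α] {f : V → α}
    (hf : Function.Injective f) (e : G.edgeSet) :
    ∃ a b, (e : Sym2 V) = s(a, b) ∧ f a < f b ∧ G.Adj a b := by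
  obtain ⟨e, he⟩ := e
  induction e using Sym2.ind with
  | _ a b =>
    have hab : G.Adj a b := he
    rcases lt_or_gt_of_ne (hf.ne hab.ne) with h | h
    · exact ⟨a, b, rfl, h, hab⟩
    · exact ⟨b, a, Sym2.eq_swap, h, hab.symm⟩

/-- The foot of the stick of an edge whose endpoints have positions `a` and `b`. -/
noncomputable def edgeFoot (a b : ℕ) : ℝ := b + 1 - 1 / (1 + b - a)

theorem edgeFoot_lt (a b : ℕ) (h : a < b) : edgeFoot a b < b + 1 := by
  have : (a : ℝ) < b := by exact_mod_cast h
  have : (0 : ℝ) < 1 / (1 + b - a) := by apply div_pos <;> linarith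
  unfold edgeFoot
  linarith

theorem le_edgeFoot (a b : ℕ) (h : a < b) : b + 1 / 2 ≤ edgeFoot a b := by
  have : (a : ℝ) + 1 ≤ b := by exact_mod_cast h
  have : (1 : ℝ) / (1 + b - a) ≤ 1 / 2 := by
    apply one_div_le_one_div_of_le <;> linarith
  unfold edgeFoot
  linarith

/-- Among edges with the same later endpoint, the longer one has its foot further right, so the
stick of an inner vertex ending at its own edge stops short of the longer edge. -/
theorem edgeFoot_lt_edgeFoot {a a' b : ℕ} (h : a < a') (h' : a' < b) :
    edgeFoot a' b < edgeFoot a b := by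
  have h1 : (a : ℝ) < a' := by exact_mod_cast h
  have h2 : (a' : ℝ) < b := by exact_mod_cast h'
  have : (1 : ℝ) / (1 + b - a) < 1 / (1 + b - a') := by
    apply one_div_lt_one_div_of_lt <;> linarith
  unfold edgeFoot
  linarith

theorem le_of_edgeFoot_le {a b a' b' : ℕ} (h : a < b) (h' : a' < b')
    (hle : edgeFoot a b ≤ edgeFoot a' b') : b ≤ b' := by
  have h1 := edgeFoot_lt a' b' h'
  have h2 := le_edgeFoot a b h
  have : (b : ℝ) < b' + 1 := by linarith
  exact Nat.lt_succ_iff.1 (by exact_mod_cast this)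

theorem edgeFoot_inj {a b a' b' : ℕ} (h : a < b) (h' : a' < b')
    (he : edgeFoot a b = edgeFoot a' b') : a = a' ∧ b = b' := by
  obtain rfl : b = b' := le_antisymm (le_of_edgeFoot_le h h' he.le) (le_of_edgeFoot_le h' h he.ge)
  refine ⟨?_, rfl⟩
  rcases lt_trichotomy a a' with hlt | heq | hgt
  · exact absurd he (edgeFoot_lt_edgeFoot hlt h').ne'
  · exact heq
  · exact absurd he (edgeFoot_lt_edgeFoot hgt h).ne

/-- Vertex sticks are horizontal and extend exactly to their furthest incident edge; edge sticks are
vertical and drop exactly to their earlier endpoint. A false intersection of `v` with `e` puts `v`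
strictly between the endpoints of `e` and gives an edge at `v` with foot no further left than that
of `e`. This edge would cross `e` or contradict the choice of feet. -/
theorem IsNoncrossingOrder.isStickGraph [Finite V] {f : V → ℕ} (hf : IsNoncrossingOrder G f) :
    IsStickGraph (comparabilityGraph (IncidencePoset G)) := by
  choose lo hi hlh hlt hadj using fun e : G.edgeSet => exists_ordered_endpoints hf.injective e
  have hmem : ∀ v (e : G.edgeSet), v ∈ (e : Sym2 V) ↔ v = lo e ∨ v = hi e := fun v e => by
    rw [hlh e, Sym2.mem_iff]
  let y : G.edgeSet → ℝ := fun e => edgeFoot (f (lo e)) (f (hi e))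
  have hy1 : ∀ e, y e < f (hi e) + 1 := fun e => edgeFoot_lt _ _ (hlt e)
  have hy2 : ∀ e, f (hi e) + 1 / 2 ≤ y e := fun e => le_edgeFoot _ _ (hlt e)
  have hlt' : ∀ e, (f (lo e) : ℝ) + 1 ≤ f (hi e) := fun e => by exact_mod_cast hlt e
  have hr : ∀ v, ∃ r : ℝ, 0 < r ∧ (∀ e : G.edgeSet, v ∈ (e : Sym2 V) → y e - f v ≤ r) ∧
      (r = 1 / 4 ∨ ∃ e : G.edgeSet, v ∈ (e : Sym2 V) ∧ r = y e - f v) := by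
    intro v
    by_cases h : ∃ e : G.edgeSet, v ∈ (e : Sym2 V)
    · obtain ⟨e, he, hmax⟩ := Set.exists_max_image {e : G.edgeSet | v ∈ (e : Sym2 V)} y
        (Set.toFinite _) h
      refine ⟨y e - f v, ?_, fun g hg => sub_le_sub_right (hmax g hg) _, Or.inr ⟨e, he, rfl⟩⟩
      have := hy2 e
      have := hlt' e
      rcases (hmem v e).1 he with rfl | rfl <;> linarith
    -- Any positive length too short to reach an edge foot suits an isolated vertex; edge feet lie
    -- at least `1/2` beyond an integer position.
    · exact ⟨1 / 4, by norm_num, fun e he => (h ⟨e, he⟩).elim, Or.inl rfl⟩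
  choose r hr0 hr1 hr2 using hr
  have hyl : ∀ e, 0 < y e - f (lo e) := fun e => by linarith [hy2 e, hlt' e]
  have key : ∀ (v : V) (e : G.edgeSet), v ∈ (e : Sym2 V) ↔
      (f v : ℝ) ≤ y e ∧ y e - f v ≤ r v ∧ 1 * (y e - f v) ≤ y e - f (lo e) := by
    intro v e
    constructor
    · intro h
      have h1 := hy2 e
      have h2 := hlt' e
      refine ⟨?_, hr1 v e h, ?_⟩ <;> rcases (hmem v e).1 h with rfl | rfl <;> linarith
    · rintro ⟨h1, h2, h3⟩
      by_contra hv
      simp only [hmem, not_or] at hv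
      have hlv : f (lo e) < f v := by
        refine lt_of_le_of_ne ?_ fun h => hv.1 (hf.injective h.symm)
        have : (f (lo e) : ℝ) ≤ f v := by linarith
        exact_mod_cast this
      have hvh : f v < f (hi e) := by
        refine lt_of_le_of_ne ?_ fun h => hv.2 (hf.injective h)
        have : (f v : ℝ) < f (hi e) + 1 := by linarith [hy1 e]
        exact Nat.lt_succ_iff.1 (by exact_mod_cast this)
      rcases hr2 v with hr | ⟨g, hg, hr⟩
      · have : (f v : ℝ) < f (hi e) := by exact_mod_cast hvh
        linarith [hy2 e]
      · have hle : y e ≤ y g := by linarith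
        have hhi : f (hi e) ≤ f (hi g) := le_of_edgeFoot_le (hlt e) (hlt g) hle
        rcases (hmem v g).1 hg with rfl | rfl
        · rcases hhi.lt_or_eq with hlt'' | heq
          · exact hf.not_adj _ _ _ _ hlv hvh hlt'' (hadj e) (hadj g)
          · refine absurd hle (not_le.2 ?_)
            simp only [y, ← heq]
            exact edgeFoot_lt_edgeFoot hlv hvh
        · omega
  let W := IncidencePoset G
  let hor : W → Bool := fun p => match p with | vertex _ => true | edge _ => false
  let ft : W → ℝ := fun p => match p with | vertex v => f v | edge e => y e
  let len : W → ℝ := fun p => match p with | vertex v => r v | edge e => y e - f (lo e)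
  have hlen : ∀ p, 0 < len p := fun p => by
    cases p with
    | vertex v => exact hr0 v
    | edge e => exact hyl e
  have hpar : ∀ p q, p ≠ q → hor p = hor q →
      Disjoint (stick 1 0 (hor p) (ft p) (len p)) (stick 1 0 (hor q) (ft q) (len q)) := by
    intro p q hpq hh
    rw [← hh]
    refine stick_disjoint_stick (hlen p) (hlen q) one_pos _ fun hft => hpq ?_
    cases p with
    | vertex v =>
      cases q with
      | vertex w =>
        have hvw : (f v : ℝ) = f w := hft
        exact congrArg vertex (hf.injective (by exact_mod_cast hvw))
      | edge e => simp [hor] at hh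
    | edge e =>
      cases q with
      | vertex w => simp [hor] at hh
      | edge g =>
        obtain ⟨h1, h2⟩ := edgeFoot_inj (hlt e) (hlt g) hft
        refine congrArg edge (Subtype.ext ?_)
        rw [hlh e, hlh g, hf.injective h1, hf.injective h2]
  refine ⟨⟨1, 0, one_pos, hor, ft, len, hlen, hpar, fun p q => ?_⟩⟩
  have hve : ∀ v e, (comparabilityGraph (IncidencePoset G)).Adj (vertex v) (edge e) ↔
      (stick 1 0 true (ft (vertex v)) (len (vertex v)) ∩
        stick 1 0 false (ft (edge e)) (len (edge e))).Nonempty := fun v e => by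
    rw [comparabilityGraph_adj_vertex_edge, key]
    exact (stick_inter_stick_nonempty (hlen (vertex v)) (hlen (edge e)) one_pos).symm
  cases p with
  | vertex v =>
    cases q with
    | vertex w =>
      refine iff_of_false not_comparabilityGraph_adj_vertex_vertex fun ⟨h1, h2⟩ => ?_
      exact Set.not_disjoint_iff_nonempty_inter.2 h2 (hpar _ _ h1 rfl)
    | edge e => exact (hve v e).trans ⟨fun h => ⟨nofun, h⟩, fun h => h.2⟩
  | edge e =>
    cases q with
    | vertex w =>
      rw [SimpleGraph.adj_comm, Set.inter_comm]
      exact (hve w e).trans ⟨fun h => ⟨nofun, h⟩, fun h => h.2⟩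
    | edge g =>
      refine iff_of_false not_comparabilityGraph_adj_edge_edge fun ⟨h1, h2⟩ => ?_
      exact Set.not_disjoint_iff_nonempty_inter.2 h2 (hpar _ _ h1 rfl)

/-! ### Drawing a graph with a noncrossing order -/

/-- The chord of the parabola `y = x²` between the abscissas `a` and `b`. -/
def parabolaChord (a b : ℝ) (t : ℝ) : ℝ × ℝ :=
  (a + t * (b - a), (a + b) * (a + t * (b - a)) - a * b)

theorem parabolaChord_zero (a b : ℝ) : parabolaChord a b 0 = (a, a ^ 2) := by
  simp only [parabolaChord, Prod.mk.injEq]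
  constructor <;> ring

theorem parabolaChord_one (a b : ℝ) : parabolaChord a b 1 = (b, b ^ 2) := by
  simp only [parabolaChord, Prod.mk.injEq]
  constructor <;> ring

/-- At abscissa `z` the chord lies `(z - a) * (b - z)` above the parabola, so points are compared by
abscissa and by this height. -/
theorem parabolaChord_eq_iff {a b c d s t : ℝ} :
    parabolaChord a b s = parabolaChord c d t ↔ a + s * (b - a) = c + t * (d - c) ∧
      (a + s * (b - a) - a) * (b - (a + s * (b - a))) =
        (a + s * (b - a) - c) * (d - (a + s * (b - a))) := by
  simp only [parabolaChord, Prod.mk.injEq]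
  refine and_congr_right fun h => ?_
  rw [← h]
  constructor <;> intro h <;> linarith

theorem IsNoncrossingOrder.isOuterplanar {f : V → ℝ} (hf : IsNoncrossingOrder G f) :
    IsOuterplanar G := by
  choose lo hi hlh hlt hadj using fun e : G.edgeSet => exists_ordered_endpoints hf.injective e
  have below : ∀ e (t : unitInterval), (parabolaChord (f (lo e)) (f (hi e)) t).1 ^ 2 ≤
      (parabolaChord (f (lo e)) (f (hi e)) t).2 := by
    intro e t
    have h := hlt e
    have h1 := mul_nonneg (mul_nonneg t.2.1 (sub_nonneg.2 t.2.2)) (sq_nonneg (f (hi e) - f (lo e)))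
    simp only [parabolaChord]
    nlinarith
  have inside : ∀ e (t : unitInterval), 0 < t → t < 1 →
      f (lo e) < f (lo e) + t * (f (hi e) - f (lo e)) ∧
        f (lo e) + t * (f (hi e) - f (lo e)) < f (hi e) := by
    intro e t h0 h1
    have h := sub_pos.2 (hlt e)
    have h0 : (0 : ℝ) < t := h0
    have h1 : (t : ℝ) < 1 := h1
    constructor <;> nlinarith
  -- Overlapping intervals must be nested by the noncrossing condition, and the chord over the
  -- larger interval is strictly higher.
  have chords : ∀ e g : G.edgeSet, ∀ z : ℝ, f (lo e) < z → z < f (hi e) → f (lo g) < z →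
      z < f (hi g) → f (lo e) < f (lo g) →
      (z - f (lo e)) * (f (hi e) - z) ≠ (z - f (lo g)) * (f (hi g) - z) := by
    intro e g z h1 h2 h3 h4 h5 h6
    have h7 : f (hi g) ≤ f (hi e) := by
      by_contra! h7
      exact hf.not_adj _ _ _ _ h5 (h3.trans h2) h7 (hadj e) (hadj g)
    nlinarith
  let D : PlaneDrawing G :=
    { point := fun v => (f v, f v ^ 2)
      point_injective := fun v w h => hf.injective (congrArg Prod.fst h)
      arc := fun e t => parabolaChord (f (lo e)) (f (hi e)) t
      arc_continuous := fun e => by unfold parabolaChord; fun_prop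
      arc_injective := fun e s t h => by
        have h1 := (parabolaChord_eq_iff.1 h).1
        exact Subtype.ext (mul_right_cancel₀ (sub_pos.2 (hlt e)).ne' (by linarith))
      arc_endpoints := fun e => by
        rw [hlh e, Sym2.map_mk, Set.Icc.coe_zero, Set.Icc.coe_one, parabolaChord_zero,
          parabolaChord_one]
      arc_ne_point := fun e t h0 h1 v h => by
        obtain ⟨h2, h3⟩ := inside e t h0 h1
        simp only [parabolaChord, Prod.mk.injEq] at h
        rw [h.1] at h2 h3 h
        have := mul_pos (sub_pos.2 h2) (sub_pos.2 h3)
        nlinarith [h.2]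
      arc_ne_arc := fun e g hne t s h0 h1 h => by
        obtain ⟨h2, h3⟩ := inside e t h0 h1
        obtain ⟨hx, hq⟩ := parabolaChord_eq_iff.1 h
        have hgs : f (lo g) ≤ f (lo g) + s * (f (hi g) - f (lo g)) ∧
            f (lo g) + s * (f (hi g) - f (lo g)) ≤ f (hi g) := by
          have := sub_pos.2 (hlt g)
          have := s.2.1
          have := s.2.2
          constructor <;> nlinarith
        rw [← hx] at hgs
        have hpos := mul_pos (sub_pos.2 h2) (sub_pos.2 h3)
        generalize f (lo e) + t * (f (hi e) - f (lo e)) = z at *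
        -- Positive height at the common point shows that it is interior to the second chord as
        -- well, although `s` may be an endpoint parameter.
        rw [hq] at hpos
        have h4 : f (lo g) < z := lt_of_le_of_ne hgs.1 (by rintro h; simp [h] at hpos)
        have h5 : z < f (hi g) := lt_of_le_of_ne hgs.2 (by rintro h; simp [h] at hpos)
        rcases lt_trichotomy (f (lo e)) (f (lo g)) with hl | hl | hl
        · exact chords e g z h2 h3 h4 h5 hl hq
        · rw [hl] at hq
          have := mul_left_cancel₀ (sub_pos.2 h4).ne' hq
          refine hne (Subtype.ext ?_)
          rw [hlh e, hlh g, hf.injective hl, hf.injective (by linarith : f (hi e) = f (hi g))]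
        · exact chords g e z h4 h5 h2 h3 hl hq.symm }
  have hsupp : ∀ p ∈ D.support, p.1 ^ 2 ≤ p.2 := by
    rintro p (⟨v, rfl⟩ | hp)
    · exact le_rfl
    · obtain ⟨e, t, rfl⟩ := Set.mem_iUnion.1 hp
      exact below e t
  have houter : ∀ p : ℝ × ℝ, p.2 < p.1 ^ 2 → p ∈ D.outerFace := by
    intro p hp
    -- The downward vertical ray from a point below the parabola is connected, unbounded and misses
    -- the drawing.
    have hcompl : {q : ℝ × ℝ | q.1 = p.1 ∧ q.2 ≤ p.2} ⊆ D.supportᶜ := by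
      rintro q ⟨h1, h2⟩ hq
      have := hsupp q hq
      rw [h1] at this
      linarith
    have hconv : Convex ℝ {q : ℝ × ℝ | q.1 = p.1 ∧ q.2 ≤ p.2} := by
      rintro q ⟨h1, h2⟩ q' ⟨h3, h4⟩ a b ha hb hab
      refine ⟨?_, ?_⟩
      · simp only [Prod.fst_add, Prod.smul_fst, smul_eq_mul, h1, h3, ← add_mul, hab, one_mul]
      · simp only [Prod.snd_add, Prod.smul_snd, smul_eq_mul]
        calc a * q.2 + b * q'.2 ≤ a * p.2 + b * p.2 := by gcongr
          _ = p.2 := by rw [← add_mul, hab, one_mul]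
    refine ⟨hcompl ⟨rfl, le_rfl⟩, fun hb => ?_⟩
    have hb' := hb.subset (hconv.isPreconnected.subset_connectedComponentIn ⟨rfl, le_rfl⟩ hcompl)
    obtain ⟨R, hR⟩ := (Metric.isBounded_iff_subset_closedBall p).1 hb'
    have := hR (show (p.1, p.2 - (|R| + 1)) ∈ _ from ⟨rfl, by
      simp only; linarith [abs_nonneg R]⟩)
    rw [Metric.mem_closedBall, Prod.dist_eq, max_le_iff, Real.dist_eq, Real.dist_eq] at this
    have h2 := this.2
    simp only [sub_sub_cancel_left, abs_neg] at h2
    linarith [le_abs_self R, le_abs_self (|R| + 1)]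
  refine ⟨D, fun v => ⟨?_, fun h => (interior_subset h).1 (Or.inl ⟨v, rfl⟩)⟩⟩
  refine Metric.mem_closure_iff.2 fun ε hε => ⟨(f v, f v ^ 2 - ε / 2), houter _ ?_, ?_⟩
  · simp only; linarith
  · rw [Prod.dist_eq, max_lt_iff, Real.dist_eq, Real.dist_eq]
    simp only [D, sub_self, abs_zero, sub_sub_cancel]
    exact ⟨hε, by rw [abs_of_pos (by linarith)]; linarith⟩

end Incidence

theorem mainTheorem11 {V : Type*} [Finite V] (G : SimpleGraph V) :
    IsStickGraph (comparabilityGraph (IncidencePoset G)) ↔ IsOuterplanar G := by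
  constructor
  · rintro ⟨R⟩
    obtain ⟨f, hf⟩ := R.exists_isNoncrossingOrder
    exact hf.isOuterplanar
  · intro h
    obtain ⟨f, hf⟩ := h.exists_isNoncrossingOrder
    exact hf.isStickGraph
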